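/- Consider $L$ items, $K$ positions ($1\le K\le L$) and a horizon $n\ge 1$. In step $t\in\{1,\dots,n\}$ an agent shows a list $R_t$ of $K$ distinct items, the attraction indicators $A_t(a)\in\{0,1\}$ are independent (over all $t$ and $a$) Bernoulli variables with means $\alpha_t(a)$, and the agent observes the position $c_t$ of the first attractive item of $R_t$ ($c_t=K+1$ if there is none). An item of $R_t$ is observed in step $t$ if its position is at most $c_t$. Let $r(R,v)=1-\prod_{i=1}^K(1-v(R(i)))$, let $$R(n)=\sum_{t=1}^n\mathbb E\Big[\max_R r(R,\alpha_t)-r(R_t,A_t)\Big]$$ be the expected regret, where the maximum is over all lists of $K$ distinct items, and let $\Upsilon_n=|\{1\le t<n:\alpha_{t+1}\ne\alpha_t\}|$. For $\epsilon\in(1/2,1)$ and an integer window size $\tau\ge 2$, CascadeSWUCB shows in step $t$ a list of $K$ items with the largest values of $$U_t(a)=\frac{X_t(a)}{N_t(a)}+\sqrt{\frac{\epsilon\ln(\min(t,\tau))}{N_t(a)}},\qquad \frac x0:=1,$$ where $N_t(a)$ and $X_t(a)$ count how often $a$ was observed and clicked in the previous $\tau$ steps; ties and the order within the list are resolved by an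 arbitrary rule based on the past observations. Let $D_t^*$ be a set of $K$ items with the largest $\alpha_t$, and let $\Delta_{a,K}=\min\{\alpha_t(a^*)-\alpha_t(a): t\le n,\ a\notin D_t^*,\ a^*\in D_t^*\}$, with $1/\Delta_{a,K}:=0$ if $a\in D^*_t$ for all $t\le n$. Assume that $\Delta_{a,K}>0$ for all other items $a$. Write $\lambda=\ln\big(1+4\sqrt{1-1/(2\epsilon)}\big)$. (i) For every integer $\tau\ge2$, $$R(n)\le L\Upsilon_n\tau+\frac{L\ln^2\tau}{\lambda}+\sum_{a}C(\tau,a)\frac{n\ln\tau}{\tau},\qquad C(\tau,a)=\frac{2}{\ln\tau}\Big\lceil\frac{\ln\tau}{\lambda}\Big\rceil+\frac{8\epsilon}{\Delta_{a,K}}\,\frac{\lceil n/\tau\rceil}{n/\tau}.$$ (ii) If $\tau\to\infty$ and $n/\tau\to\infty$ while $1/\Delta_{a,K}$ stays fixed (or converges in $[0,\infty)$), then $C(\tau,a)$ converges to $\dfrac{2}{\lambda}+\dfrac{8\epsilon}{\Delta_{a,K}}$ (with the limit of $1/\Delta_{a,K}$). (iii) If $\Upsilon_n\ge1$ and $\tau=2\sqrt{n\ln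 n/\Upsilon_n}$, rounded up or down to an integer, then $R(n)=O\big(\sqrt{n\Upsilon_n\ln n}\big)$: for every $\delta>0$ there is a constant that depends only on $L,K,\epsilon,\delta$ such that the bound holds with this constant for all $n$ and all environments all of whose gaps $\alpha_t(a^*)-\alpha_t(a)$ ($t\le n$, $a\notin D_t^*$, $a^*\in D_t^*$) are at least $\delta$. -/

import Mathlib

open MeasureTheory ProbabilityTheory Filter Topology

namespace CascadeBandit

/-- Ranked lists: `K` distinct items out of `L`; `R i` is the item at position `i`
(positions are numbered from `0` to `K - 1`). -/
abbrev Ranking (L K : ℕ) := Fin K ↪ Fin L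

/-- The reward function `r(R, v) = 1 - ∏ᵢ (1 - v(R(i)))`. -/
noncomputable def reward {L K : ℕ} (R : Ranking L K) (v : Fin L → ℝ) : ℝ :=
  1 - ∏ i, (1 - v (R i))

/-- The click feedback of the cascade model: the first position that holds an attractive item,
and `K` (no click) if there is none. -/
def click {L K : ℕ} (R : Ranking L K) (x : Fin L → Bool) : ℕ :=
  Nat.find (p := fun i => ∀ h : i < K, x (R ⟨i, h⟩) = true) ⟨K, fun h => absurd h (lt_irrefl K)⟩

/-- What the agent has seen so far: the displayed lists with their clicks, most recent first. -/
abbrev History (L K : ℕ) := List (Ranking L K × ℕ)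

open scoped Classical in
/-- Number of times that item `a` was observed (displayed at or above the position of the click)
in the last `τ` rounds. -/
noncomputable def obsCount {L K : ℕ} (τ : ℕ) (h : History L K) (a : Fin L) : ℕ :=
  (h.take τ).countP (fun e => decide (∃ i : Fin K, e.1 i = a ∧ (i : ℕ) ≤ e.2))

open scoped Classical in
/-- Number of times that item `a` was clicked in the last `τ` rounds. -/
noncomputable def clickCount {L K : ℕ} (τ : ℕ) (h : History L K) (a : Fin L) : ℕ :=
  (h.take τ).countP (fun e => decide (∃ i : Fin K, e.1 i = a ∧ (i : ℕ) = e.2))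

/-- Division with the convention `x / 0 = 1`. -/
noncomputable def divOne (x : ℝ) (m : ℕ) : ℝ := if m = 0 then 1 else x / m

/-- The sliding-window upper confidence bound of item `a` in step `t = h.length + 1`:
the average observed attraction in the window plus `√(ε ln(t ∧ τ) / N)`. -/
noncomputable def ucb {L K : ℕ} (ε : ℝ) (τ : ℕ) (h : History L K) (a : Fin L) : ℝ :=
  divOne (clickCount τ h a) (obsCount τ h a)
    + √(divOne (ε * Real.log ((min (h.length + 1) τ : ℕ) : ℝ)) (obsCount τ h a))

/-- `σ` is a version of CascadeSWUCB: after every history it displays `K` items with the largest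
upper confidence bounds. Ties and the order within the list are resolved arbitrarily. -/
def IsCascadeSWUCB {L K : ℕ} (ε : ℝ) (τ : ℕ) (σ : History L K → Ranking L K) : Prop :=
  ∀ h : History L K, ∀ a ∈ Set.range (σ h), ∀ b ∉ Set.range (σ h), ucb ε τ h b ≤ ucb ε τ h a

/-- The history after `t` rounds, when the policy `σ` faces the attraction indicators
`x 0, x 1, …` (rounds are numbered from `0`). -/
def history {L K : ℕ} (σ : History L K → Ranking L K) (x : ℕ → Fin L → Bool) : ℕ → History L K
  | 0 => []
  | t + 1 => (σ (history σ x t), click (σ (history σ x t)) (x t)) :: history σ x t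

/-- The environment over `n` rounds: the attraction indicators `A t a` (item `a`, round `t < n`)
are independent Bernoulli variables with means `α t a`. -/
structure IsEnvironment {L : ℕ} {Ω : Type*} [MeasurableSpace Ω] (μ : Measure Ω) (n : ℕ)
    (α : ℕ → Fin L → ℝ) (A : ℕ → Fin L → Ω → Bool) : Prop where
  measurable : ∀ t < n, ∀ a, Measurable (A t a)
  indep : iIndepFun (fun p : Fin n × Fin L => A p.1 p.2) μ
  law : ∀ t < n, ∀ a, μ.real {ω | A t a ω = true} = α t a

/-- The expected `n`-step regret of the policy `σ`. -/
noncomputable def regret {L K : ℕ} {Ω : Type*} [MeasurableSpace Ω] (μ : Measure Ω)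
    (α : ℕ → Fin L → ℝ) (A : ℕ → Fin L → Ω → Bool) (σ : History L K → Ranking L K) (n : ℕ) : ℝ :=
  ∑ t ∈ Finset.range n, ∫ ω, ((⨆ R : Ranking L K, reward R (α t))
    - reward (σ (history σ (fun s a => A s a ω) t)) (fun a => if A t a ω = true then 1 else 0)) ∂μ

open scoped Classical in
/-- The number of changes of the attraction probabilities within the `n` rounds. -/
noncomputable def numChanges {L : ℕ} (α : ℕ → Fin L → ℝ) (n : ℕ) : ℕ :=
  ((Finset.range n).filter (fun t => t + 1 < n ∧ α (t + 1) ≠ α t)).card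

/-- `D t` is a set of `K` most attractive items in each of the `n` rounds. -/
def IsOptimalSets {L : ℕ} (K n : ℕ) (α : ℕ → Fin L → ℝ) (D : ℕ → Finset (Fin L)) : Prop :=
  ∀ t < n, (D t).card = K ∧ ∀ b ∈ D t, ∀ a ∉ D t, α t a ≤ α t b

/-- The smallest gap `Δ` between item `a` and an optimal item, over the rounds in which `a` is
suboptimal. -/
noncomputable def gap {L : ℕ} (α : ℕ → Fin L → ℝ) (D : ℕ → Finset (Fin L)) (n : ℕ) (a : Fin L) :
    ℝ :=
  sInf {x | ∃ t < n, a ∉ D t ∧ ∃ b ∈ D t, x = α t b - α t a}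

open scoped Classical in
/-- The reciprocal `1 / Δ` of the smallest gap; it is `0` for an item that is never suboptimal
(a minimum over the empty set is `+∞`). -/
noncomputable def invGap {L : ℕ} (α : ℕ → Fin L → ℝ) (D : ℕ → Finset (Fin L)) (n : ℕ)
    (a : Fin L) : ℝ :=
  if ∃ t < n, a ∉ D t then 1 / gap α D n a else 0

/-- `ln(1 + 4 √(1 - 1/(2ε)))`. -/
noncomputable def logEta (ε : ℝ) : ℝ := Real.log (1 + 4 * √(1 - 1 / (2 * ε)))

/-- The constant `C(τ, a)`, as a function of `n` and of the reciprocal gap `g = 1 / Δ` of `a`. -/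
noncomputable def swConst (ε : ℝ) (n τ : ℕ) (g : ℝ) : ℝ :=
  2 / Real.log τ * (⌈Real.log τ / logEta ε⌉ : ℝ)
    + 8 * ε * g * ((⌈(n : ℝ) / τ⌉ : ℝ) / ((n : ℝ) / τ))

end CascadeBandit

universe u

open CascadeBandit

/-! Rounds are sorted by what their window has seen. If the means changed inside the window, the
round costs at most 1, and one change spoils at most `τ` windows. In every other round all
observations in the window share the current means, and either some confidence bound fails or all
hold.

Failure. The number `N` of observations of an item is random and depends on the clicks, so
Hoeffding's inequality for a fixed sample size does not apply. Instead `exp(θ(X - pN) - θ²N/8)` has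
expectation at most 1 (`integral_expDev_le_one`), because whether an item is observed depends only
on the items above it. The best `θ` depends on `N`; hence the range of `N` is peeled into `⌈ln T /
λ⌉` geometric slices of ratio `1 + η`, with `T = min(t, τ)` and one `θ` for each slice. The loss
from the mismatch is a factor `1 - η²/16`, and `η = 4√(1 - 1/(2ε))` is exactly the value for which
the exponent is still `ln T`. So a bound fails with probability at most `⌈ln T / λ⌉ / T`
(`integral_deviates_le`), and `sum_ceil_log_min_le` adds this up over the rounds.

Success. Pair each displayed suboptimal item with an undisplayed optimal one. The loss telescopes
over the positions, and the weight of a position is the probability that it is observed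
(`iSup_reward_sub_le`). Thus a gap is paid only when the item is observed. The comparison of the
indices bounds the gap by `2√(c/N)` with `c = ε ln τ`, and rules out `N > 4c/Δ²` (`sub_le_penalty`).
Within a block of `τ` rounds every observation in the block so far is still in the window, so these
payments sum to at most `8c/Δ` per item and block (`sum_observed_penalty_le`), and there are `⌈n/τ⌉`
blocks.

The limit of the constant holds because a ceiling is asymptotic to its argument, and the rate
follows by inserting the tuned window. -/

namespace CascadeBandit

/-! ### One round: product law of a row, observation probabilities, loss of a list -/

section Rows

variable {L K : ℕ}

/-- The probability of a row `y` of independent Bernoulli variables with means `v`. -/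
def rowWeight (v : Fin L → ℝ) (y : Fin L → Bool) : ℝ :=
  ∏ a, if y a = true then v a else 1 - v a

theorem rowWeight_nonneg {v : Fin L → ℝ} (hv : ∀ a, v a ∈ Set.Icc (0 : ℝ) 1)
    (y : Fin L → Bool) : 0 ≤ rowWeight v y := by
  refine Finset.prod_nonneg fun a _ => ?_
  have := hv a
  split_ifs
  · exact this.1
  · linarith [this.2]

/-- The sum over rows factorises over items. As `R` is injective, each item carries at most one
factor `g i`, and an item without one contributes `v a + (1 - v a) = 1`. -/
theorem sum_rowWeight_mul_prod (v : Fin L → ℝ) (R : Ranking L K) (I : Finset (Fin K))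
    (g : Fin K → Bool → ℝ) :
    ∑ y, rowWeight v y * ∏ i ∈ I, g i (y (R i))
      = ∏ i ∈ I, (v (R i) * g i true + (1 - v (R i)) * g i false) := by
  set F : Fin L → Bool → ℝ := fun a b =>
    (if b = true then v a else 1 - v a) * ∏ i ∈ I with R i = a, g i b with hF
  have h1 : ∀ y : Fin L → Bool, rowWeight v y * ∏ i ∈ I, g i (y (R i)) = ∏ a, F a (y a) := by
    intro y
    rw [hF, Finset.prod_mul_distrib, rowWeight, ← Finset.prod_fiberwise I (fun i => R i)]
    congr 1
    refine Finset.prod_congr rfl fun a _ => Finset.prod_congr rfl fun i hi => ?_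
    rw [(Finset.mem_filter.1 hi).2]
  simp only [h1]
  have h2 : ∑ y : Fin L → Bool, ∏ a, F a (y a) = ∏ a, ∑ b, F a b := by
    rw [Finset.prod_univ_sum, Fintype.piFinset_univ]
  rw [h2]
  have h3 : ∏ i ∈ I, (v (R i) * g i true + (1 - v (R i)) * g i false)
      = ∏ a ∈ I.map R, ∑ b, F a b := by
    rw [Finset.prod_map]
    refine Finset.prod_congr rfl fun i hi => ?_
    have : (I.filter fun j => R j = R i) = {i} := by
      ext j
      simp only [Finset.mem_filter, Finset.mem_singleton, R.injective.eq_iff]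
      exact ⟨fun h => h.2, fun h => ⟨h ▸ hi, h⟩⟩
    simp only [hF, this, Finset.prod_singleton, Fintype.sum_bool]
    simp
  rw [h3]
  symm
  refine Finset.prod_subset (Finset.subset_univ _) fun a _ ha => ?_
  have : (I.filter fun j => R j = a) = ∅ := by
    rw [Finset.filter_eq_empty_iff]
    intro j hj h
    exact ha (Finset.mem_map.2 ⟨j, hj, h⟩)
  simp [hF, this]

theorem sum_rowWeight (v : Fin L → ℝ) : ∑ y, rowWeight v y = 1 := by
  have h : ∑ y : Fin L → Bool, rowWeight v y =
      ∏ a, ∑ b : Bool, (if b = true then v a else 1 - v a) := by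
    rw [Finset.prod_univ_sum, Fintype.piFinset_univ]
    rfl
  rw [h]
  simp

theorem le_click_iff (R : Ranking L K) (y : Fin L → Bool) (k : Fin K) :
    (k : ℕ) ≤ click R y ↔ ∀ i < k, y (R i) = false := by
  rw [click, Nat.le_find_iff]
  constructor
  · intro h i hi
    have := h i hi
    push Not at this
    obtain ⟨_, h2⟩ := this
    simpa using h2
  · intro h m hm
    push Not
    refine ⟨hm.trans k.2, ?_⟩
    simp [h ⟨m, hm.trans k.2⟩ hm]

theorem eq_click_iff (R : Ranking L K) (y : Fin L → Bool) (k : Fin K) :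
    (k : ℕ) = click R y ↔ (k : ℕ) ≤ click R y ∧ y (R k) = true := by
  constructor
  · intro h
    refine ⟨h.le, ?_⟩
    have hs : ∀ h : click R y < K, y (R ⟨click R y, h⟩) = true :=
      Nat.find_spec (p := fun i => ∀ h : i < K, y (R ⟨i, h⟩) = true) _
    have hk : click R y < K := h ▸ k.2
    have := hs hk
    convert this
  · rintro ⟨h1, h2⟩
    exact le_antisymm h1 (Nat.find_min' _ fun _ => h2)

theorem indicator_le_click (R : Ranking L K) (y : Fin L → Bool) (k : Fin K) :
    (if (k : ℕ) ≤ click R y then (1 : ℝ) else 0)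
      = ∏ i ∈ Finset.Iio k, if y (R i) = true then (0 : ℝ) else 1 := by
  split_ifs with h
  · rw [le_click_iff] at h
    symm
    refine Finset.prod_eq_one fun i hi => ?_
    simp [h i (Finset.mem_Iio.1 hi)]
  · rw [le_click_iff] at h
    push Not at h
    obtain ⟨i, hi, h2⟩ := h
    symm
    refine Finset.prod_eq_zero (Finset.mem_Iio.2 hi) ?_
    simpa using h2

/-- A position is observed exactly when no item above it is attractive. This turns the weights in
the telescoped loss into observation probabilities. -/
theorem sum_rowWeight_le_click (v : Fin L → ℝ) (R : Ranking L K) (k : Fin K) :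
    ∑ y, rowWeight v y * (if (k : ℕ) ≤ click R y then (1 : ℝ) else 0)
      = ∏ i ∈ Finset.Iio k, (1 - v (R i)) := by
  simp only [indicator_le_click]
  rw [sum_rowWeight_mul_prod v R (Finset.Iio k) (fun _ b => if b = true then (0 : ℝ) else 1)]
  simp

theorem sum_rowWeight_mul_reward (v : Fin L → ℝ) (R : Ranking L K) :
    ∑ y, rowWeight v y * reward R (fun a => if y a = true then 1 else 0) = reward R v := by
  have h := sum_rowWeight_mul_prod v R Finset.univ (fun _ b => 1 - if b = true then (1 : ℝ) else 0)
  simp only [reward, mul_sub, Finset.sum_sub_distrib, mul_one, sum_rowWeight]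
  rw [h]
  simp

theorem reward_mem_Icc {v : Fin L → ℝ} (hv : ∀ a, v a ∈ Set.Icc (0 : ℝ) 1) (R : Ranking L K) :
    reward R v ∈ Set.Icc (0 : ℝ) 1 := by
  have h0 : 0 ≤ ∏ i, (1 - v (R i)) := Finset.prod_nonneg fun i _ => by linarith [(hv (R i)).2]
  have h1 : ∏ i, (1 - v (R i)) ≤ 1 := Finset.prod_le_one
    (fun i _ => by linarith [(hv (R i)).2]) (fun i _ => by linarith [(hv (R i)).1])
  constructor <;> simp only [reward] <;> linarith

/-- Rearrangement of a set `D` of `K` items into a list that agrees with `R` on the items that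
they share. -/
theorem exists_aligned_ranking (R : Ranking L K) (D : Finset (Fin L)) (hD : D.card = K) :
    ∃ S : Ranking L K, (∀ k, S k ∈ D) ∧ (∀ k, R k ∈ D → S k = R k) ∧
      ∀ k, R k ∉ D → S k ∉ Set.range R := by
  classical
  set P : Finset (Fin K) := Finset.univ.filter fun k => R k ∉ D with hP
  set Q : Finset (Fin L) := D \ Finset.univ.map R with hQ
  have hcard : P.card = Q.card := by
    have h1 : P.card = (Finset.univ.map R \ D).card := by
      rw [← Finset.card_map R]
      congr 1
      ext a
      simp only [hP, Finset.mem_map, Finset.mem_filter, Finset.mem_univ, true_and,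
        Finset.mem_sdiff]
      constructor
      · rintro ⟨k, hk, rfl⟩
        exact ⟨⟨k, rfl⟩, hk⟩
      · rintro ⟨⟨k, rfl⟩, hk⟩
        exact ⟨k, hk, rfl⟩
    rw [h1]
    exact Finset.card_sdiff_comm (by simp [hD])
  -- Both sets have `K - |R ∩ D|` elements, so the suboptimal positions can be filled bijectively
  -- with the undisplayed elements of `D`.
  let e : P ≃ Q := Finset.equivOfCardEq hcard
  have hmem : ∀ k, R k ∉ D → k ∈ P := fun k hk => by simp [hP, hk]
  let f : Fin K → Fin L := fun k => if h : R k ∈ D then R k else e ⟨k, hmem k h⟩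
  have hf1 : ∀ k, R k ∈ D → f k = R k := fun k h => by simp [f, h]
  have hf2 : ∀ k (h : R k ∉ D), f k = e ⟨k, hmem k h⟩ := fun k h => by simp [f, h]
  have hf3 : ∀ k, R k ∉ D → f k ∈ D ∧ f k ∉ Set.range R := by
    intro k h
    have := (e ⟨k, hmem k h⟩).2
    rw [hf2 k h]
    obtain ⟨hm, hn⟩ := Finset.mem_sdiff.1 this
    exact ⟨hm, fun ⟨j, hj⟩ => hn (Finset.mem_map.2 ⟨j, Finset.mem_univ _, hj⟩)⟩
  refine ⟨⟨f, ?_⟩, ?_, hf1, fun k h => (hf3 k h).2⟩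
  · intro i j hij
    by_cases hi : R i ∈ D <;> by_cases hj : R j ∈ D
    · rw [hf1 i hi, hf1 j hj] at hij
      exact R.injective hij
    · exact absurd ⟨i, by rw [← hij, hf1 i hi]⟩ (hf3 j hj).2
    · exact absurd ⟨j, by rw [hij, hf1 j hj]⟩ (hf3 i hi).2
    · rw [hf2 i hi, hf2 j hj] at hij
      simpa using e.injective (Subtype.ext hij)
  · intro k
    by_cases h : R k ∈ D
    · show f k ∈ D
      rw [hf1 k h]; exact h
    · exact (hf3 k h).1

theorem reward_le_of_aligned {v : Fin L → ℝ} (hv : ∀ a, v a ∈ Set.Icc (0 : ℝ) 1)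
    {R S : Ranking L K} (h : ∀ k, v (R k) ≤ v (S k)) : reward R v ≤ reward S v := by
  have : ∏ i, (1 - v (S i)) ≤ ∏ i, (1 - v (R i)) := Finset.prod_le_prod
    (fun i _ => by linarith [(hv (S i)).2]) (fun i _ => by linarith [h i])
  simp only [reward]
  linarith

theorem reward_eq_of_forall_mem {v : Fin L → ℝ} {D : Finset (Fin L)} (hD : D.card = K)
    {S : Ranking L K} (h : ∀ k, S k ∈ D) : reward S v = 1 - ∏ a ∈ D, (1 - v a) := by
  have : Finset.univ.map S = D := by
    refine Finset.eq_of_subset_of_card_le (fun a ha => ?_) (by simp [hD])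
    obtain ⟨k, _, rfl⟩ := Finset.mem_map.1 ha
    exact h k
  rw [reward, ← this, Finset.prod_map]

theorem iSup_reward_le {v : Fin L → ℝ} (hv : ∀ a, v a ∈ Set.Icc (0 : ℝ) 1)
    {D : Finset (Fin L)} (hD : D.card = K) (hopt : ∀ b ∈ D, ∀ a ∉ D, v a ≤ v b)
    {S : Ranking L K} (hS : ∀ k, S k ∈ D) : ⨆ R : Ranking L K, reward R v ≤ reward S v := by
  have : Nonempty (Ranking L K) := ⟨S⟩
  refine ciSup_le fun R => ?_
  obtain ⟨S', h1, h2, -⟩ := exists_aligned_ranking R D hD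
  rw [reward_eq_of_forall_mem hD hS, ← reward_eq_of_forall_mem hD h1]
  refine reward_le_of_aligned hv fun k => ?_
  by_cases hk : R k ∈ D
  · rw [h2 k hk]
  · exact hopt _ (h1 k) _ hk

/-- The factors `f` are replaced by `g` one position at a time; the product of `g` behind the
current position is at most 1 and is dropped. The prefix keeps `f`, which for the displayed list is
the probability of observing position `k`. -/
theorem prod_sub_prod_le {f g : Fin K → ℝ} (hg : ∀ i, 0 ≤ g i) (hgf : ∀ i, g i ≤ f i)
    (hf : ∀ i, f i ≤ 1) :
    ∏ i, f i - ∏ i, g i ≤ ∑ k, (∏ i ∈ Finset.Iio k, f i) * (f k - g k) := by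
  have h := Finset.prod_add_ordered (Finset.univ : Finset (Fin K)) g (fun i => f i - g i)
  simp only [add_sub_cancel] at h
  rw [h, add_sub_cancel_left]
  refine Finset.sum_le_sum fun k _ => ?_
  have e : (Finset.univ.filter fun j => j < k) = Finset.Iio k := by ext; simp
  rw [e, mul_comm (f k - g k), mul_assoc]
  refine mul_le_mul_of_nonneg_left ?_ (Finset.prod_nonneg fun i _ => (hg i).trans (hgf i))
  refine mul_le_of_le_one_right (by linarith [hgf k]) ?_
  exact Finset.prod_le_one (fun i _ => hg i) fun i _ => (hgf i).trans (hf i)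

/-- The loss of a list, split over the positions that hold suboptimal items. -/
theorem iSup_reward_sub_le {v : Fin L → ℝ} (hv : ∀ a, v a ∈ Set.Icc (0 : ℝ) 1)
    {D : Finset (Fin L)} (hD : D.card = K) (hopt : ∀ b ∈ D, ∀ a ∉ D, v a ≤ v b)
    (R : Ranking L K) (φ : Fin L → ℝ)
    (hφ : ∀ a ∈ Set.range R, a ∉ D → ∀ b ∈ D, b ∉ Set.range R → v b - v a ≤ φ a) :
    (⨆ R : Ranking L K, reward R v) - reward R v
      ≤ ∑ k, (∏ i ∈ Finset.Iio k, (1 - v (R i))) * (if R k ∈ D then 0 else φ (R k)) := by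
  obtain ⟨S, h1, h2, h3⟩ := exists_aligned_ranking R D hD
  have hle : ∀ k, v (R k) ≤ v (S k) := fun k => by
    by_cases hk : R k ∈ D
    · rw [h2 k hk]
    · exact hopt _ (h1 k) _ hk
  have h4 := iSup_reward_le hv hD hopt h1
  have h5 := prod_sub_prod_le (f := fun i => 1 - v (R i)) (g := fun i => 1 - v (S i))
    (fun i => by linarith [(hv (S i)).2]) (fun i => by linarith [hle i])
    (fun i => by linarith [(hv (R i)).1])
  have h6 : (⨆ R : Ranking L K, reward R v) - reward R v
      ≤ ∏ i, (1 - v (R i)) - ∏ i, (1 - v (S i)) := by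
    simp only [reward] at h4 ⊢
    linarith
  refine (h6.trans h5).trans (Finset.sum_le_sum fun k _ => ?_)
  refine mul_le_mul_of_nonneg_left ?_ (Finset.prod_nonneg fun i _ => by linarith [(hv (R i)).2])
  split_ifs with hk
  · rw [h2 k hk]; simp
  · linarith [hφ (R k) ⟨k, rfl⟩ hk (S k) (h1 k) (h3 k hk)]

end Rows

/-! ### Conditioning on the history -/

section Expectation

variable {L K : ℕ}

theorem history_congr (σ : History L K → Ranking L K) {x y : ℕ → Fin L → Bool} {t : ℕ}
    (h : ∀ s < t, x s = y s) : history σ x t = history σ y t := by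
  induction t with
  | zero => rfl
  | succ t ih =>
    simp only [history]
    rw [ih fun s hs => h s (hs.trans t.lt_succ_self), h t t.lt_succ_self]

theorem length_history (σ : History L K → Ranking L K) (x : ℕ → Fin L → Bool) (t : ℕ) :
    (history σ x t).length = t := by
  induction t with
  | zero => rfl
  | succ t ih => simp [history, ih]

/-- The rounds before `t`, as indices of the indicators. -/
def pastIndices (L n t : ℕ) : Finset (Fin n × Fin L) := Finset.univ.filter fun p => (p.1 : ℕ) < t

/-- The history as a function of the past indicators. -/
def historyOfPast (σ : History L K → Ranking L K) (n t : ℕ)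
    (z : pastIndices L n t → Bool) : History L K :=
  history σ (fun s a => if h : ∃ hs : s < n, (⟨s, hs⟩, a) ∈ pastIndices L n t then
    z ⟨(⟨s, h.1⟩, a), h.2⟩ else false) t

/-- The history before round `t` reads only rounds before `t`, so the default `false` at the other
indices is never used. This makes the history a function of a finite tuple, from which
measurability, integrability and independence follow. -/
theorem history_eq_historyOfPast (σ : History L K → Ranking L K) {n t : ℕ} (ht : t ≤ n)
    (x : ℕ → Fin L → Bool) :
    history σ x t
      = historyOfPast σ n t (fun p => x (p : Fin n × Fin L).1 (p : Fin n × Fin L).2) := by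
  refine history_congr σ fun s hs => ?_
  funext a
  have : ∃ hs : s < n, ((⟨s, hs⟩, a) : Fin n × Fin L) ∈ pastIndices L n t :=
    ⟨hs.trans_le ht, by simp [pastIndices, hs]⟩
  simp only [dif_pos this]

variable {Ω : Type*} [MeasurableSpace Ω] {μ : Measure Ω}

theorem integrable_comp_of_finite [IsFiniteMeasure μ] {β : Type*} [Finite β] [MeasurableSpace β]
    [DiscreteMeasurableSpace β] {X : Ω → β} (hX : Measurable X) (F : β → ℝ) :
    Integrable (fun ω => F (X ω)) μ := by
  cases nonempty_fintype β
  refine Integrable.of_bound ((Measurable.of_discrete (f := F)).comp hX).aestronglyMeasurable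
    (∑ b, ‖F b‖) (ae_of_all _ fun ω => ?_)
  exact Finset.single_le_sum (f := fun b => ‖F b‖) (fun _ _ => norm_nonneg _)
    (Finset.mem_univ (X ω))

theorem integral_comp_of_indepFun [IsProbabilityMeasure μ] {β γ : Type*}
    [Finite β] [MeasurableSpace β] [DiscreteMeasurableSpace β]
    [Fintype γ] [MeasurableSpace γ] [DiscreteMeasurableSpace γ]
    {X : Ω → β} {Y : Ω → γ} (hX : Measurable X) (hY : Measurable Y) (h : IndepFun X Y μ)
    (G : β → γ → ℝ) :
    ∫ ω, G (X ω) (Y ω) ∂μ = ∫ ω, ∑ y, μ.real {ω | Y ω = y} * G (X ω) y ∂μ := by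
  classical
  have h1 : ∀ ω, G (X ω) (Y ω) = ∑ y, G (X ω) y * (if Y ω = y then 1 else 0) := by
    intro ω; simp
  have hiX : ∀ y, Integrable (fun ω => G (X ω) y) μ := fun y =>
    integrable_comp_of_finite hX fun b => G b y
  have hiXY : ∀ y, Integrable (fun ω => G (X ω) y * (if Y ω = y then (1 : ℝ) else 0)) μ :=
    fun y => integrable_comp_of_finite (hX.prodMk hY)
      fun p => G p.1 y * (if p.2 = y then (1 : ℝ) else 0)
  simp only [h1]
  rw [integral_finsetSum _ fun y _ => hiXY y, integral_finsetSum _ fun y _ => (hiX y).const_mul _]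
  refine Finset.sum_congr rfl fun y _ => ?_
  have hind : IndepFun (fun ω => G (X ω) y) (fun ω => if Y ω = y then (1 : ℝ) else 0) μ :=
    h.comp (φ := fun b => G b y) (ψ := fun c => if c = y then (1 : ℝ) else 0)
      Measurable.of_discrete Measurable.of_discrete
  rw [hind.integral_fun_mul_eq_mul_integral
    (hiX y).aestronglyMeasurable
    (integrable_comp_of_finite hY fun c => if c = y then (1 : ℝ) else 0).aestronglyMeasurable,
    integral_const_mul, mul_comm]
  congr 1
  have hm : MeasurableSet {ω | Y ω = y} := hY (MeasurableSet.of_discrete (s := {y}))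
  rw [← integral_indicator_one hm]
  refine integral_congr_ae (ae_of_all _ fun ω => ?_)
  simp [Set.indicator_apply]

variable {n : ℕ} {α : ℕ → Fin L → ℝ} {A : ℕ → Fin L → Ω → Bool}

theorem IsEnvironment.mem_Icc [IsProbabilityMeasure μ] (hA : IsEnvironment μ n α A) {t : ℕ}
    (ht : t < n) (a : Fin L) : α t a ∈ Set.Icc (0 : ℝ) 1 := by
  rw [← hA.law t ht a]
  exact ⟨measureReal_nonneg, measureReal_le_one⟩

theorem IsEnvironment.measurable_row (hA : IsEnvironment μ n α A) {t : ℕ} (ht : t < n) :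
    Measurable (fun ω a => A t a ω) :=
  measurable_pi_lambda _ fun a => hA.measurable t ht a

theorem IsEnvironment.measureReal_row_eq [IsProbabilityMeasure μ] (hA : IsEnvironment μ n α A)
    {t : ℕ} (ht : t < n) (y : Fin L → Bool) :
    μ.real {ω | (fun a => A t a ω) = y} = rowWeight (α t) y := by
  have hinj : Function.Injective fun a : Fin L => ((⟨t, ht⟩, a) : Fin n × Fin L) :=
    fun a b h => (Prod.ext_iff.1 h).2
  have hi := hA.indep.precomp hinj
  have h := hi.measure_inter_preimage_eq_mul Finset.univ (sets := fun a => {y a})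
    fun a _ => MeasurableSet.of_discrete
  have he : {ω | (fun a => A t a ω) = y}
      = ⋂ a ∈ (Finset.univ : Finset (Fin L)), A t a ⁻¹' {y a} := by
    ext ω; simp [funext_iff]
  rw [he, measureReal_def]
  beta_reduce at h
  rw [h, ENNReal.toReal_prod, rowWeight]
  refine Finset.prod_congr rfl fun a _ => ?_
  have hl := hA.law t ht a
  have hm : MeasurableSet {ω | A t a ω = true} :=
    hA.measurable t ht a (MeasurableSet.of_discrete (s := {true}))
  split_ifs with hy
  · rw [← hl, hy]; rfl
  · rw [← hl, ← probReal_compl_eq_one_sub hm, measureReal_def]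
    congr 2
    ext ω
    simp [hy]

theorem IsEnvironment.measurable_past (hA : IsEnvironment μ n α A) (t : ℕ) :
    Measurable (fun ω (p : pastIndices L n t) =>
      A (p : Fin n × Fin L).1 (p : Fin n × Fin L).2 ω) :=
  measurable_pi_lambda _ fun p => hA.measurable _ p.1.1.2 _

theorem IsEnvironment.integrable_history [IsProbabilityMeasure μ] (hA : IsEnvironment μ n α A)
    (σ : History L K → Ranking L K) {t : ℕ} (ht : t ≤ n) (F : History L K → ℝ) :
    Integrable (fun ω => F (history σ (fun s a => A s a ω) t)) μ := by
  simp only [history_eq_historyOfPast σ ht]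
  exact integrable_comp_of_finite (hA.measurable_past t) fun z => F (historyOfPast σ n t z)

theorem IsEnvironment.integrable_history_row [IsProbabilityMeasure μ]
    (hA : IsEnvironment μ n α A) (σ : History L K → Ranking L K) {t : ℕ} (ht : t < n)
    (F : History L K → (Fin L → Bool) → ℝ) :
    Integrable (fun ω => F (history σ (fun s a => A s a ω) t) (fun a => A t a ω)) μ := by
  simp only [history_eq_historyOfPast σ ht.le]
  exact integrable_comp_of_finite ((hA.measurable_past t).prodMk (hA.measurable_row ht))
    fun z => F (historyOfPast σ n t z.1) z.2

/-- Conditional expectation given the history: the next row has its product law. -/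
theorem IsEnvironment.integral_history_row [IsProbabilityMeasure μ]
    (hA : IsEnvironment μ n α A) (σ : History L K → Ranking L K) {t : ℕ} (ht : t < n)
    (F : History L K → (Fin L → Bool) → ℝ) :
    ∫ ω, F (history σ (fun s a => A s a ω) t) (fun a => A t a ω) ∂μ
      = ∫ ω, ∑ y, rowWeight (α t) y * F (history σ (fun s a => A s a ω) t) y ∂μ := by
  set T : Finset (Fin n × Fin L) := Finset.univ.filter fun p => (p.1 : ℕ) = t with hT
  have hdisj : Disjoint (pastIndices L n t) T := by
    rw [Finset.disjoint_left]
    intro p hp hp'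
    simp only [pastIndices, hT, Finset.mem_filter] at hp hp'
    omega
  -- The past and round `t` use disjoint sets of indices of an independent family.
  have hind := hA.indep.indepFun_finset _ _ hdisj fun p => hA.measurable _ p.1.2 _
  have hind2 := hind.comp (φ := id)
    (ψ := fun z (a : Fin L) => z ⟨(⟨t, ht⟩, a), by simp [hT]⟩) measurable_id
    Measurable.of_discrete
  have h := integral_comp_of_indepFun (hA.measurable_past t) (hA.measurable_row ht) hind2
    fun z y => F (historyOfPast σ n t z) y
  simp only [history_eq_historyOfPast σ ht.le]
  rw [h]
  simp only [hA.measureReal_row_eq ht]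

end Expectation

/-! ### The exponential supermartingale of the observed clicks -/

section Supermartingale

/-- Hoeffding's lemma for a Bernoulli variable. -/
theorem bernoulli_exp_le {p : ℝ} (hp : p ∈ Set.Icc (0 : ℝ) 1) (θ : ℝ) :
    p * Real.exp (θ * (1 - p) - θ ^ 2 / 8) + (1 - p) * Real.exp (θ * (0 - p) - θ ^ 2 / 8) ≤ 1 := by
  set ν : Measure Bool := ENNReal.ofReal p • Measure.dirac true
    + ENNReal.ofReal (1 - p) • Measure.dirac false with hν
  have hq : 0 ≤ 1 - p := by linarith [hp.2]
  have hprob : IsProbabilityMeasure ν := ⟨by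
    simp [hν, ← ENNReal.ofReal_add hp.1 hq]⟩
  have hint : ∀ f : Bool → ℝ, ∫ b, f b ∂ν = p * f true + (1 - p) * f false := by
    intro f
    have h1 : IsFiniteMeasure (ENNReal.ofReal p • Measure.dirac true) :=
      Measure.smul_finite _ ENNReal.ofReal_ne_top
    have h2 : IsFiniteMeasure (ENNReal.ofReal (1 - p) • Measure.dirac false) :=
      Measure.smul_finite _ ENNReal.ofReal_ne_top
    rw [hν, integral_add_measure (Integrable.of_finite) (Integrable.of_finite),
      integral_smul_measure, integral_smul_measure, integral_dirac, integral_dirac,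
      ENNReal.toReal_ofReal hp.1, ENNReal.toReal_ofReal hq]
    simp
  have h := (hasSubgaussianMGF_of_mem_Icc (μ := ν) (a := 0) (b := 1)
    (X := fun b : Bool => if b = true then (1 : ℝ) else 0)
    (Measurable.of_discrete).aemeasurable
    (ae_of_all _ fun b => by cases b <;> simp)).mgf_le θ
  rw [mgf, hint, hint] at h
  simp only [if_true, Bool.false_eq_true, if_false, mul_one, mul_zero, add_zero] at h
  -- The variance proxy of a variable in an interval of length 1 is `(1/2)²`, whence the `θ²/8`.
  have he : Real.exp ((((‖(1 : ℝ) - 0‖₊ / 2) ^ 2 : NNReal) : ℝ) * θ ^ 2 / 2)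
      = Real.exp (θ ^ 2 / 8) := by
    congr 1
    simp
    ring
  rw [he] at h
  rw [Real.exp_sub, Real.exp_sub, ← mul_div_assoc, ← mul_div_assoc, ← add_div,
    div_le_one (Real.exp_pos _)]
  exact h

variable {L K : ℕ}

/-- The item `a` was displayed at or above the position of the click. -/
def Observed (e : Ranking L K × ℕ) (a : Fin L) : Prop := ∃ i : Fin K, e.1 i = a ∧ (i : ℕ) ≤ e.2

/-- The item `a` was clicked. -/
def Clicked (e : Ranking L K × ℕ) (a : Fin L) : Prop := ∃ i : Fin K, e.1 i = a ∧ (i : ℕ) = e.2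

theorem observed_iff (R : Ranking L K) (c : ℕ) (k : Fin K) :
    Observed (R, c) (R k) ↔ (k : ℕ) ≤ c :=
  ⟨fun ⟨i, h, h'⟩ => by rwa [← R.injective h], fun h => ⟨k, rfl, h⟩⟩

theorem clicked_iff (R : Ranking L K) (c : ℕ) (k : Fin K) :
    Clicked (R, c) (R k) ↔ (k : ℕ) = c :=
  ⟨fun ⟨i, h, h'⟩ => by rwa [← R.injective h], fun h => ⟨k, rfl, h⟩⟩

theorem Clicked.observed {e : Ranking L K × ℕ} {a : Fin L} (h : Clicked e a) : Observed e a := by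
  obtain ⟨i, h1, h2⟩ := h
  exact ⟨i, h1, h2.le⟩

open scoped Classical in
theorem obsCount_cons (m : ℕ) (e : Ranking L K × ℕ) (h : History L K) (a : Fin L) :
    obsCount (m + 1) (e :: h) a = obsCount m h a + if Observed e a then 1 else 0 := by
  simp [obsCount, Observed, List.countP_cons]
  congr

open scoped Classical in
theorem clickCount_cons (m : ℕ) (e : Ranking L K × ℕ) (h : History L K) (a : Fin L) :
    clickCount (m + 1) (e :: h) a = clickCount m h a + if Clicked e a then 1 else 0 := by
  simp [clickCount, Clicked, List.countP_cons]
  congr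

theorem obsCount_zero (h : History L K) (a : Fin L) : obsCount 0 h a = 0 := by simp [obsCount]

theorem clickCount_zero (h : History L K) (a : Fin L) : clickCount 0 h a = 0 := by
  simp [clickCount]

theorem obsCount_min_length (τ : ℕ) (h : History L K) (a : Fin L) :
    obsCount (min h.length τ) h a = obsCount τ h a := by
  rcases le_total h.length τ with hl | hl
  · simp [obsCount, min_eq_left hl, List.take_of_length_le hl]
  · rw [min_eq_right hl]

theorem clickCount_min_length (τ : ℕ) (h : History L K) (a : Fin L) :
    clickCount (min h.length τ) h a = clickCount τ h a := by
  rcases le_total h.length τ with hl | hl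
  · simp [clickCount, min_eq_left hl, List.take_of_length_le hl]
  · rw [min_eq_right hl]

theorem obsCount_mono {m τ : ℕ} (hm : m ≤ τ) (h : History L K) (a : Fin L) :
    obsCount m h a ≤ obsCount τ h a :=
  ((List.take_prefix_take_left hm).sublist).countP_le

theorem obsCount_le (m : ℕ) (h : History L K) (a : Fin L) : obsCount m h a ≤ m :=
  List.countP_le_length.trans (List.length_take_le _ _)

/-- The exponential of the centred clicks, compensated by the number of observations. -/
noncomputable def expDev (θ p : ℝ) (a : Fin L) (m : ℕ) (h : History L K) : ℝ :=
  Real.exp (θ * (clickCount m h a - p * obsCount m h a) - θ ^ 2 / 8 * obsCount m h a)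

open scoped Classical in
theorem expDev_cons (θ p : ℝ) (a : Fin L) (m : ℕ) (e : Ranking L K × ℕ) (h : History L K) :
    expDev θ p a (m + 1) (e :: h) = expDev θ p a m h *
      Real.exp (θ * ((if Clicked e a then 1 else 0) - p * (if Observed e a then 1 else 0))
        - θ ^ 2 / 8 * (if Observed e a then 1 else 0)) := by
  rw [expDev, expDev, ← Real.exp_add, obsCount_cons, clickCount_cons]
  congr 1
  push_cast
  ring

-- One step of the supermartingale. If `a` is at position `k`, the exponential is 1 unless position
-- `k` is observed. That event depends only on the items above and is independent of the indicator
-- of `a`, so Hoeffding's lemma applies to the remaining factor.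
open scoped Classical in
theorem sum_rowWeight_exp_le {v : Fin L → ℝ} (hv : ∀ a, v a ∈ Set.Icc (0 : ℝ) 1) (θ : ℝ)
    (R : Ranking L K) (a : Fin L) :
    ∑ y, rowWeight v y * Real.exp (θ * ((if Clicked (R, click R y) a then 1 else 0)
        - v a * (if Observed (R, click R y) a then 1 else 0))
        - θ ^ 2 / 8 * (if Observed (R, click R y) a then 1 else 0)) ≤ 1 := by
  by_cases ha : a ∈ Set.range R
  · obtain ⟨k, rfl⟩ := ha
    set E : Bool → ℝ := fun b => Real.exp (θ * ((if b = true then 1 else 0) - v (R k)) - θ ^ 2 / 8)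
      with hE
    set G : Fin K → Bool → ℝ := fun i b => if i = k then E b else if b = true then 0 else 1 with hG
    have h1 : ∀ y : Fin L → Bool,
        Real.exp (θ * ((if Clicked (R, click R y) (R k) then 1 else 0)
          - v (R k) * (if Observed (R, click R y) (R k) then 1 else 0))
          - θ ^ 2 / 8 * (if Observed (R, click R y) (R k) then 1 else 0))
        -- On the observed event the exponential becomes a product over the positions up to `k`, to
        -- which the product law applies.
        = 1 - (if (k : ℕ) ≤ click R y then 1 else 0)
          + ∏ i ∈ insert k (Finset.Iio k), G i (y (R i)) := by
      intro y
      have h2 : ∏ i ∈ insert k (Finset.Iio k), G i (y (R i))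
          = E (y (R k)) * (if (k : ℕ) ≤ click R y then 1 else 0) := by
        rw [Finset.prod_insert (by simp), indicator_le_click]
        congr 1
        · simp [hG]
        · refine Finset.prod_congr rfl fun i hi => ?_
          simp [hG, (Finset.mem_Iio.1 hi).ne]
      rw [h2, clicked_iff, observed_iff, eq_click_iff]
      by_cases ho : (k : ℕ) ≤ click R y
      · by_cases hy : y (R k) = true <;> simp [hE, ho, hy]
      · simp [ho]
    simp only [h1]
    simp only [mul_add, mul_sub, Finset.sum_add_distrib, Finset.sum_sub_distrib, mul_one]
    rw [sum_rowWeight, sum_rowWeight_le_click, sum_rowWeight_mul_prod,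
      Finset.prod_insert (by simp)]
    have h3 : ∏ i ∈ Finset.Iio k, (v (R i) * G i true + (1 - v (R i)) * G i false)
        = ∏ i ∈ Finset.Iio k, (1 - v (R i)) := by
      refine Finset.prod_congr rfl fun i hi => ?_
      simp [hG, (Finset.mem_Iio.1 hi).ne]
    rw [h3]
    have h4 : v (R k) * G k true + (1 - v (R k)) * G k false ≤ 1 := by
      have := bernoulli_exp_le (hv (R k)) θ
      simpa [hG, hE] using this
    have h5 : 0 ≤ ∏ i ∈ Finset.Iio k, (1 - v (R i)) :=
      Finset.prod_nonneg fun i _ => by linarith [(hv (R i)).2]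
    nlinarith
  · have h1 : ∀ c, ¬ Observed (R, c) a := fun c ⟨i, h, _⟩ => ha ⟨i, h⟩
    have h2 : ∀ c, ¬ Clicked (R, c) a := fun c h => h1 c h.observed
    simp [h1, h2, sum_rowWeight]

variable {Ω : Type*} [MeasurableSpace Ω] {μ : Measure Ω} [IsProbabilityMeasure μ]
  {n : ℕ} {α : ℕ → Fin L → ℝ} {A : ℕ → Fin L → Ω → Bool}

/-- The start `t - m` of the window stays fixed in the induction: the window of length `m + 1` at
time `t + 1` is the window of length `m` at time `t` plus the newest round. Only the mean of `a`
inside the window has to be constant. -/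
theorem IsEnvironment.integral_expDev_le_one (hA : IsEnvironment μ n α A)
    (σ : History L K → Ranking L K) (θ p : ℝ) (a : Fin L) (m t : ℕ) (hmt : m ≤ t) (ht : t ≤ n)
    (hp : ∀ s < t, t ≤ s + m → α s a = p) :
    ∫ ω, expDev θ p a m (history σ (fun s a => A s a ω) t) ∂μ ≤ 1 := by
  classical
  induction m generalizing t with
  | zero => simp [expDev, obsCount_zero, clickCount_zero]
  | succ m ih =>
    obtain ⟨t, rfl⟩ : ∃ s, t = s + 1 := ⟨t - 1, by omega⟩
    have hpt : α t a = p := hp t (by omega) (by omega)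
    have hv : ∀ b, α t b ∈ Set.Icc (0 : ℝ) 1 := fun b => hA.mem_Icc (by omega) b
    simp only [history]
    rw [hA.integral_history_row σ (by omega : t < n)
      (fun h y => expDev θ p a (m + 1) ((σ h, click (σ h) y) :: h))]
    refine le_trans (integral_mono ?_ ?_ fun ω => ?_)
      (ih t (by omega) (by omega) fun s hs hs' => hp s (by omega) (by omega))
    · exact hA.integrable_history σ (by omega) fun h =>
        ∑ y, rowWeight (α t) y * expDev θ p a (m + 1) ((σ h, click (σ h) y) :: h)
    · exact hA.integrable_history σ (by omega) fun h => expDev θ p a m h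
    · beta_reduce
      simp only [expDev_cons, mul_left_comm (rowWeight _ _), ← Finset.mul_sum]
      refine mul_le_of_le_one_right (Real.exp_pos _).le ?_
      rw [← hpt]
      exact sum_rowWeight_exp_le hv θ _ a

end Supermartingale

/-! ### Peeling over the random number of observations -/

section Peeling

theorem logEta_pos {ε : ℝ} (hε : ε ∈ Set.Ioo (1 / 2 : ℝ) 1) : 0 < logEta ε := by
  have h1 : 1 / (2 * ε) < 1 := by
    rw [div_lt_one (by linarith [hε.1])]; linarith [hε.1]
  have h2 : 0 < √(1 - 1 / (2 * ε)) := Real.sqrt_pos.2 (by linarith)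
  exact Real.log_pos (by linarith)

/-- Keeps the cost of rounding up the number of slices small enough for `sum_ceil_log_div_le`. -/
theorem logEta_le_two {ε : ℝ} (hε : ε ∈ Set.Ioo (1 / 2 : ℝ) 1) : logEta ε ≤ 2 := by
  have h0 : 0 < 1 / (2 * ε) := by have := hε.1; positivity
  have h2 : √(1 - 1 / (2 * ε)) ≤ 1 := Real.sqrt_le_one.2 (by linarith)
  have h3 := Real.sqrt_nonneg (1 - 1 / (2 * ε))
  have he : (5 : ℝ) ≤ Real.exp 2 := by
    have := Real.quadratic_le_exp_of_nonneg (show (0 : ℝ) ≤ 2 by norm_num)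
    linarith
  rw [logEta, Real.log_le_iff_le_exp (by linarith)]
  linarith

/-- The parameter of the exponential supermartingale that is tuned to the `k`-th slice. -/
noncomputable def sliceParam (δ l : ℝ) (k : ℕ) : ℝ := 4 * δ * Real.exp (-((k + 1 / 2) * l / 2))

/-- For known `N` the best parameter is `4δ/√N`; `sliceParam` puts the geometric midpoint of the
slice in place of `N`. With `u` the square root of the ratio of `N` to the midpoint, the exponent at
the threshold is `2δ²(1 - (1 - u)²)`, and `u` lies within a factor `(1 + η)^(1/4)` of 1. -/
theorem sliceParam_exponent {δ η N x : ℝ} {k : ℕ} (hδ : 0 ≤ δ) (hη : 0 ≤ η) (hN : 0 < N)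
    (h1 : k * Real.log (1 + η) ≤ Real.log N) (h2 : Real.log N ≤ (k + 1) * Real.log (1 + η))
    (hx : δ * √N ≤ x) :
    2 * δ ^ 2 * (1 - η ^ 2 / 16)
      ≤ sliceParam δ (Real.log (1 + η)) k * x - sliceParam δ (Real.log (1 + η)) k ^ 2 / 8 * N := by
  set l := Real.log (1 + η) with hl
  set e := Real.exp (-((k + 1 / 2) * l / 2)) with he
  set u := √N * e with hu
  set w := Real.exp (l / 4) with hw
  have hu_exp : u = Real.exp ((Real.log N - (k + 1 / 2) * l) / 2) := by
    have h3 : √N = Real.exp (Real.log N / 2) := by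
      rw [← Real.log_sqrt hN.le, Real.exp_log (Real.sqrt_pos.2 hN)]
    rw [hu, h3, he, ← Real.exp_add]
    congr 1
    ring
  have hw_pos : 0 < w := Real.exp_pos _
  have hw4 : w ^ 4 = 1 + η := by
    rw [hw, ← Real.exp_nat_mul]
    have : ((4 : ℕ) : ℝ) * (l / 4) = l := by push_cast; ring
    rw [this, hl, Real.exp_log (by linarith)]
  -- Bernoulli's inequality `1 + 4(w - 1) ≤ w⁴ = 1 + η`.
  have hw1 : w - 1 ≤ η / 4 := by
    have := one_add_mul_le_pow (a := w - 1) (by linarith) 4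
    simp only [add_sub_cancel, hw4] at this
    push_cast at this
    linarith
  have hu1 : u ≤ w := by
    rw [hu_exp, hw, Real.exp_le_exp]
    linarith
  have hu2 : 2 - w ≤ u := by
    have h3 : w⁻¹ ≤ u := by
      rw [hu_exp, hw, ← Real.exp_neg, Real.exp_le_exp]
      linarith
    have h4 : 2 - w ≤ w⁻¹ := by
      rw [← sub_nonneg]
      have : w⁻¹ - (2 - w) = (w - 1) ^ 2 * w⁻¹ := by field_simp; ring
      rw [this]
      positivity
    linarith
  have hsq : (1 - u) ^ 2 ≤ η ^ 2 / 16 := by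
    have : (1 - u) ^ 2 ≤ (η / 4) ^ 2 := sq_le_sq' (by linarith) (by linarith)
    linarith
  have hθ : sliceParam δ l k = 4 * δ * e := rfl
  have hNu : e ^ 2 * N = u ^ 2 := by rw [hu, mul_pow, Real.sq_sqrt hN.le]; ring
  have h5 : 4 * δ * e * (δ * √N) ≤ 4 * δ * e * x :=
    mul_le_mul_of_nonneg_left hx (by positivity)
  have h6 : 4 * δ * e * (δ * √N) = 4 * δ ^ 2 * u := by rw [hu]; ring
  have h7 : (4 * δ * e) ^ 2 / 8 * N = 2 * δ ^ 2 * u ^ 2 := by rw [← hNu]; ring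
  rw [hθ, h7]
  nlinarith [mul_le_mul_of_nonneg_left hsq (sq_nonneg δ)]

/-- The slices are closed at both ends, so that `N = T` fits into the last one even if `ln T / l` is
an integer. For `N = 1` the truncated subtraction gives slice 0. -/
theorem exists_slice {l N T : ℝ} (hl : 0 < l) (hN : 1 ≤ N) (hNT : N ≤ T) (hT : 1 < T) :
    ∃ k : ℕ, k < ⌈Real.log T / l⌉₊ ∧ k * l ≤ Real.log N ∧ Real.log N ≤ (k + 1) * l := by
  have hlog : 0 ≤ Real.log N := Real.log_nonneg hN
  have hD : 0 < ⌈Real.log T / l⌉₊ := Nat.ceil_pos.2 (div_pos (Real.log_pos hT) hl)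
  have hle : ⌈Real.log N / l⌉₊ ≤ ⌈Real.log T / l⌉₊ := Nat.ceil_mono (by gcongr)
  refine ⟨⌈Real.log N / l⌉₊ - 1, by omega, ?_, ?_⟩
  · rcases Nat.eq_zero_or_pos ⌈Real.log N / l⌉₊ with h | h
    · simp [h, hlog]
    · have h1 : ⌈Real.log N / l⌉₊ - 1 < ⌈Real.log N / l⌉₊ := by omega
      have := Nat.lt_ceil.1 h1
      rw [lt_div_iff₀ hl] at this
      exact this.le
  · have h1 := Nat.le_ceil (Real.log N / l)
    rw [div_le_iff₀ hl] at h1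
    refine h1.trans (mul_le_mul_of_nonneg_right ?_ hl.le)
    have : ⌈Real.log N / l⌉₊ ≤ ⌈Real.log N / l⌉₊ - 1 + 1 := by omega
    exact_mod_cast this

variable {L K : ℕ}

/-- The number of rounds that a window may use in the current round. -/
def effWindow (τ : ℕ) (h : History L K) : ℕ := min (h.length + 1) τ

/-- The average of the observed indicators of `a` deviates from `p` in direction `s` by at least
the confidence radius. -/
def Deviates (ε : ℝ) (τ : ℕ) (s p : ℝ) (a : Fin L) (h : History L K) : Prop :=
  1 ≤ obsCount τ h a ∧
    √(ε * Real.log (effWindow τ h)) * √(obsCount τ h a)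
      ≤ s * (clickCount τ h a - p * obsCount τ h a)

-- Markov's inequality in pointwise form: on a deviation, the exponential tuned to the slice of `N`
-- is at least `T`. The window length `min h.length τ` never exceeds the elapsed time, as
-- `integral_expDev_le_one` requires.
open scoped Classical in
theorem indicator_deviates_le {ε : ℝ} (hε : ε ∈ Set.Ioo (1 / 2 : ℝ) 1) {τ : ℕ} (hτ : 2 ≤ τ)
    {s : ℝ} (hs : s ^ 2 = 1) (p : ℝ) (a : Fin L) (h : History L K) :
    (if Deviates ε τ s p a h then (1 : ℝ) else 0)
      ≤ ∑ k ∈ Finset.range ⌈Real.log (effWindow τ h) / logEta ε⌉₊,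
        (effWindow τ h : ℝ)⁻¹ *
          expDev (s * sliceParam √(ε * Real.log (effWindow τ h)) (logEta ε) k) p a
            (min h.length τ) h := by
  have hnn : ∀ k ∈ Finset.range ⌈Real.log (effWindow τ h) / logEta ε⌉₊,
      0 ≤ (effWindow τ h : ℝ)⁻¹ *
          expDev (s * sliceParam √(ε * Real.log (effWindow τ h)) (logEta ε) k) p a
            (min h.length τ) h :=
    fun k _ => mul_nonneg (by positivity) (Real.exp_pos _).le
  split_ifs with hd
  swap
  · exact Finset.sum_nonneg hnn
  obtain ⟨h1, h2⟩ := hd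
  have hNm : obsCount τ h a ≤ min h.length τ := by
    rw [← obsCount_min_length]; exact obsCount_le _ _ _
  have hT2 : 2 ≤ effWindow τ h := by unfold effWindow; omega
  have hNT : obsCount τ h a ≤ effWindow τ h := by unfold effWindow; omega
  have hT2' : (2 : ℝ) ≤ effWindow τ h := by exact_mod_cast hT2
  have hl := logEta_pos hε
  obtain ⟨k, hk, hk1, hk2⟩ := exists_slice hl (N := obsCount τ h a) (T := effWindow τ h)
    (by exact_mod_cast h1) (by exact_mod_cast hNT) (by linarith)
  refine le_trans ?_ (Finset.single_le_sum hnn (Finset.mem_range.2 hk))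
  have hlog : 0 ≤ Real.log (effWindow τ h) := Real.log_nonneg (by linarith)
  have hε0 : 0 < ε := by linarith [hε.1]
  have hq : 0 ≤ 1 - 1 / (2 * ε) := by
    rw [sub_nonneg, div_le_one (by linarith)]; linarith [hε.1]
  have key := sliceParam_exponent (δ := √(ε * Real.log (effWindow τ h)))
    (η := 4 * √(1 - 1 / (2 * ε))) (N := obsCount τ h a) (k := k) (Real.sqrt_nonneg _)
    (by positivity) (by exact_mod_cast h1) hk1 hk2 h2
  -- This identity dictates the choice of `η`: `1 - η²/16 = 1/(2ε)` cancels the factor `2ε`.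
  have hval : 2 * √(ε * Real.log (effWindow τ h)) ^ 2 * (1 - (4 * √(1 - 1 / (2 * ε))) ^ 2 / 16)
      = Real.log (effWindow τ h) := by
    rw [mul_pow, Real.sq_sqrt hq, Real.sq_sqrt (mul_nonneg hε0.le hlog)]
    field_simp
    ring
  rw [hval] at key
  rw [expDev, obsCount_min_length, clickCount_min_length, ← div_eq_inv_mul,
    one_le_div (by linarith), ← Real.log_le_iff_le_exp (by linarith)]
  refine key.trans (le_of_eq ?_)
  rw [mul_pow, hs]
  simp only [logEta]
  ring

variable {Ω : Type*} [MeasurableSpace Ω] {μ : Measure Ω} [IsProbabilityMeasure μ]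
  {n : ℕ} {α : ℕ → Fin L → ℝ} {A : ℕ → Fin L → Ω → Bool}

open scoped Classical in
theorem IsEnvironment.integral_deviates_le (hA : IsEnvironment μ n α A)
    (σ : History L K → Ranking L K) {ε : ℝ} (hε : ε ∈ Set.Ioo (1 / 2 : ℝ) 1) {τ : ℕ}
    (hτ : 2 ≤ τ) {s : ℝ} (hs : s ^ 2 = 1) (p : ℝ) (a : Fin L) {t : ℕ} (ht : t ≤ n)
    (hp : ∀ r < t, t ≤ r + τ → α r a = p) :
    ∫ ω, (if Deviates ε τ s p a (history σ (fun r b => A r b ω) t) then (1 : ℝ) else 0) ∂μ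
      ≤ ⌈Real.log (min (t + 1) τ : ℕ) / logEta ε⌉₊ / (min (t + 1) τ : ℕ) := by
  set T := min (t + 1) τ with hT
  set θ : ℕ → ℝ := fun k => s * sliceParam √(ε * Real.log T) (logEta ε) k with hθ
  have hint : ∀ k, Integrable (fun ω => (T : ℝ)⁻¹ *
      expDev (θ k) p a (min t τ) (history σ (fun r b => A r b ω) t)) μ := fun k =>
    hA.integrable_history σ ht fun h => (T : ℝ)⁻¹ * expDev (θ k) p a (min t τ) h
  calc ∫ ω, (if Deviates ε τ s p a (history σ (fun r b => A r b ω) t) then (1 : ℝ) else 0) ∂μ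
      ≤ ∫ ω, ∑ k ∈ Finset.range ⌈Real.log T / logEta ε⌉₊, (T : ℝ)⁻¹ *
          expDev (θ k) p a (min t τ) (history σ (fun r b => A r b ω) t) ∂μ := by
        refine integral_mono (hA.integrable_history σ ht fun h =>
          if Deviates ε τ s p a h then (1 : ℝ) else 0)
          (integrable_finsetSum _ fun k _ => hint k) fun ω => ?_
        have := indicator_deviates_le hε hτ hs p a (history σ (fun r b => A r b ω) t)
        simpa only [effWindow, length_history] using this
    _ = ∑ k ∈ Finset.range ⌈Real.log T / logEta ε⌉₊, (T : ℝ)⁻¹ *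
          ∫ ω, expDev (θ k) p a (min t τ) (history σ (fun r b => A r b ω) t) ∂μ := by
        rw [integral_finsetSum _ fun k _ => hint k]
        simp only [integral_const_mul]
    _ ≤ ∑ k ∈ Finset.range ⌈Real.log T / logEta ε⌉₊, (T : ℝ)⁻¹ := by
        refine Finset.sum_le_sum fun k _ => mul_le_of_le_one_right (by positivity) ?_
        refine hA.integral_expDev_le_one σ (θ k) p a (min t τ) t (min_le_left _ _) ht ?_
        intro r hr hr'
        exact hp r hr (hr'.trans (by omega))
    _ = ⌈Real.log T / logEta ε⌉₊ / T := by
        simp [div_eq_mul_inv]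

end Peeling

/-! ### Payments for observed suboptimal items, block by block -/

section Blocks

/-- A bound on the gap of an item that was observed `j` times, in rounds where the confidence
bounds hold; it vanishes once the gap `Δ` has to be resolved. -/
noncomputable def penalty (c Δ : ℝ) (j : ℕ) : ℝ :=
  if Δ ^ 2 * j ≤ 4 * c then 2 * √c / √(max j 1 : ℕ) else 0

theorem penalty_nonneg (c Δ : ℝ) (j : ℕ) : 0 ≤ penalty c Δ j := by
  unfold penalty
  split_ifs <;> positivity

theorem penalty_antitone (c Δ : ℝ) : Antitone (penalty c Δ) := by
  intro i j hij
  have hij' : (i : ℝ) ≤ j := by exact_mod_cast hij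
  by_cases hj : Δ ^ 2 * j ≤ 4 * c
  · have hi : Δ ^ 2 * i ≤ 4 * c := le_trans (by gcongr) hj
    rw [penalty, penalty, if_pos hi, if_pos hj]
    have : (0 : ℝ) < (max i 1 : ℕ) := by exact_mod_cast (by omega : 0 < max i 1)
    gcongr
  · rw [penalty, if_neg hj]
    exact penalty_nonneg _ _ _

/-- The `-1` is kept because it later absorbs the payment at count 0. -/
theorem sum_inv_sqrt_le (m : ℕ) : ∑ j ∈ Finset.range (m + 1), 1 / √((j + 1 : ℕ) : ℝ)
    ≤ 2 * √((m + 1 : ℕ) : ℝ) - 1 := by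
  induction m with
  | zero => norm_num
  | succ m ih =>
    rw [Finset.sum_range_succ]
    set x := √((m + 1 : ℕ) : ℝ) with hx
    set y := √((m + 1 + 1 : ℕ) : ℝ) with hy
    have hx2 : x ^ 2 = m + 1 := by rw [hx, Real.sq_sqrt (by positivity)]; push_cast; ring
    have hy2 : y ^ 2 = m + 2 := by rw [hy, Real.sq_sqrt (by positivity)]; push_cast; ring
    have hy0 : 0 < y := Real.sqrt_pos.2 (by positivity)
    have h : 1 / y ≤ 2 * y - 2 * x := by
      rw [div_le_iff₀ hy0]
      nlinarith [sq_nonneg (x - y)]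
    linarith

/-- Only counts up to `⌊4c/Δ²⌋` pay, so the sum is at most `4√c · √(4c/Δ²)`. The hypotheses on `c`
and `Δ` make this cutoff at least 1. -/
theorem sum_penalty_le {c Δ : ℝ} (hc : 1 / 4 ≤ c) (hΔ : 0 < Δ) (hΔ1 : Δ ≤ 1) (M : ℕ) :
    ∑ j ∈ Finset.range M, penalty c Δ j ≤ 8 * c / Δ := by
  set r : ℝ := 4 * c / Δ ^ 2 with hr
  have hr1 : 1 ≤ r := by
    rw [hr, le_div_iff₀ (by positivity)]
    nlinarith
  obtain ⟨m, hm⟩ : ∃ m, ⌊r⌋₊ = m + 1 :=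
    ⟨⌊r⌋₊ - 1, by have := Nat.one_le_floor_iff r |>.2 hr1; omega⟩
  have hcond : ∀ j : ℕ, Δ ^ 2 * j ≤ 4 * c → j < m + 1 + 1 := by
    intro j hj
    have : j ≤ ⌊r⌋₊ := Nat.le_floor (by rw [hr, le_div_iff₀ (by positivity)]; linarith)
    omega
  have h1 : ∑ j ∈ Finset.range M, penalty c Δ j
      ≤ ∑ j ∈ Finset.range (m + 1 + 1), 2 * √c / √(max j 1 : ℕ) := by
    have h2 : ∑ j ∈ Finset.range M, penalty c Δ j
        = ∑ j ∈ (Finset.range M).filter (· < m + 1 + 1), penalty c Δ j := by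
      symm
      refine Finset.sum_filter_of_ne fun j _ hj => ?_
      by_contra hlt
      exact hj (if_neg fun h => hlt (hcond j h))
    rw [h2]
    refine (Finset.sum_le_sum_of_subset_of_nonneg (fun j hj => ?_)
      fun j _ _ => penalty_nonneg _ _ _).trans (Finset.sum_le_sum fun j _ => ?_)
    · exact Finset.mem_range.2 (Finset.mem_filter.1 hj).2
    · unfold penalty
      split_ifs
      · exact le_rfl
      · positivity
  have h3 : ∑ j ∈ Finset.range (m + 1 + 1), 2 * √c / √(max j 1 : ℕ)
      ≤ 2 * √c * (2 * √((m + 1 : ℕ) : ℝ)) := by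
    rw [Finset.sum_range_succ']
    have h4 : ∑ j ∈ Finset.range (m + 1), 2 * √c / √(max (j + 1) 1 : ℕ)
        = 2 * √c * ∑ j ∈ Finset.range (m + 1), 1 / √((j + 1 : ℕ) : ℝ) := by
      rw [Finset.mul_sum]
      refine Finset.sum_congr rfl fun j _ => ?_
      rw [max_eq_left (by omega : 1 ≤ j + 1)]
      ring
    rw [h4]
    have h5 := mul_le_mul_of_nonneg_left (sum_inv_sqrt_le m) (by positivity : 0 ≤ 2 * √c)
    simp only [zero_le, max_eq_right, Nat.cast_one, Real.sqrt_one]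
    linarith
  have h6 : √((m + 1 : ℕ) : ℝ) ≤ 2 * √c / Δ := by
    refine Real.sqrt_le_left (by positivity) |>.2 ?_
    rw [← hm, div_pow, mul_pow, Real.sq_sqrt (by linarith)]
    refine (Nat.floor_le (by linarith)).trans (le_of_eq ?_)
    rw [hr]; ring
  refine (h1.trans h3).trans ((mul_le_mul_of_nonneg_left (mul_le_mul_of_nonneg_left h6
    (by norm_num : (0 : ℝ) ≤ 2)) (by positivity)).trans (le_of_eq ?_))
  have : √c ^ 2 = c := Real.sq_sqrt (by linarith)
  field_simp
  rw [this]
  ring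

-- `B` counts the events so far and takes the values `0, 1, 2, …` at successive events; since `φ` is
-- antitone, the larger count `N` may be replaced by `B`.
open scoped Classical in
theorem sum_penalty_count_le {φ : ℕ → ℝ} (hφ : Antitone φ) (o : ℕ → Prop) (B N : ℕ → ℕ)
    (hB0 : B 0 = 0) (hB : ∀ i, B (i + 1) = B i + if o i then 1 else 0) (u : ℕ)
    (hN : ∀ i < u, B i ≤ N i) :
    ∑ i ∈ Finset.range u, (if o i then φ (N i) else 0) ≤ ∑ j ∈ Finset.range (B u), φ j := by
  induction u with
  | zero => simp [hB0]
  | succ u ih =>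
    have := ih fun i hi => hN i (hi.trans u.lt_succ_self)
    rw [Finset.sum_range_succ, hB]
    split_ifs with h
    · rw [Finset.sum_range_succ]
      exact add_le_add this (hφ (hN u u.lt_succ_self))
    · simpa using this

theorem sum_range_mul_le {f : ℕ → ℝ} {τ : ℕ} {C : ℝ}
    (h : ∀ b, ∑ i ∈ Finset.range τ, f (b * τ + i) ≤ C) (q : ℕ) :
    ∑ t ∈ Finset.range (q * τ), f t ≤ q * C := by
  induction q with
  | zero => simp
  | succ q ih =>
    rw [Nat.succ_mul, Finset.sum_range_add]
    push_cast
    linarith [h q]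

variable {L K : ℕ}

open scoped Classical in
/-- The penalties of an item along a path, block by block. -/
theorem sum_observed_penalty_le (σ : History L K → Ranking L K) (x : ℕ → Fin L → Bool)
    (a : Fin L) {c Δ : ℝ} (hc : 1 / 4 ≤ c) (hΔ : 0 < Δ) (hΔ1 : Δ ≤ 1) {τ : ℕ} (hτ : 0 < τ)
    (n : ℕ) :
    ∑ t ∈ Finset.range n,
      (if Observed (σ (history σ x t), click (σ (history σ x t)) (x t)) a then
        penalty c Δ (obsCount τ (history σ x t) a) else 0)
      ≤ ⌈(n : ℝ) / τ⌉ * (8 * c / Δ) := by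
  have hτ' : (0 : ℝ) < τ := by exact_mod_cast hτ
  set f : ℕ → ℝ := fun t =>
    if Observed (σ (history σ x t), click (σ (history σ x t)) (x t)) a then
      penalty c Δ (obsCount τ (history σ x t) a) else 0 with hf
  have hf0 : ∀ t, 0 ≤ f t := fun t => by
    simp only [hf]; split_ifs
    · exact penalty_nonneg _ _ _
    · exact le_rfl
  have hn : n ≤ ⌈(n : ℝ) / τ⌉₊ * τ := by
    have := Nat.le_ceil ((n : ℝ) / τ)
    rw [div_le_iff₀ hτ'] at this
    exact_mod_cast this
  have hblock : ∀ b, ∑ i ∈ Finset.range τ, f (b * τ + i) ≤ 8 * c / Δ := by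
    intro b
    refine le_trans (sum_penalty_count_le (penalty_antitone c Δ)
      (fun i => Observed (σ (history σ x (b * τ + i)),
        click (σ (history σ x (b * τ + i))) (x (b * τ + i))) a)
      -- At offset `i` in the block, the last `i` rounds are exactly the rounds of the block so far.
      (fun i => obsCount i (history σ x (b * τ + i)) a)
      (fun i => obsCount τ (history σ x (b * τ + i)) a) (obsCount_zero _ _) (fun i => ?_) τ
      fun i hi => obsCount_mono hi.le _ _) (sum_penalty_le hc hΔ hΔ1 _)
    exact obsCount_cons i _ _ a
  rw [← natCast_ceil_eq_intCast_ceil (by positivity)]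
  -- The horizon is extended to whole blocks; the added terms are nonnegative.
  exact (Finset.sum_le_sum_of_subset_of_nonneg (Finset.range_subset_range.2 hn)
    fun t _ _ => hf0 t).trans (sum_range_mul_le hblock _)

end Blocks

/-! ### Summing the failure probabilities -/

section Logarithms

/-- Induction with increments: `1/(n+1) ≤ y - x` for the consecutive logarithms `x` and `y`, and `(y
+ l)(y - x)` is at most the increment of `ln² + 2 ln` because `l ≤ 2`. The first summand vanishes.
-/
theorem sum_ceil_log_div_le {l : ℝ} (hl : 0 < l) (hl2 : l ≤ 2) (n : ℕ) :
    ∑ t ∈ Finset.range n, (⌈Real.log (t + 1 : ℕ) / l⌉₊ : ℝ) / (t + 1 : ℕ)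
      ≤ (Real.log n ^ 2 + 2 * Real.log n) / l := by
  induction n with
  | zero => simp
  | succ n ih =>
    rcases Nat.eq_zero_or_pos n with rfl | hn
    · simp
    have hn' : (1 : ℝ) ≤ n := by exact_mod_cast hn
    rw [Finset.sum_range_succ]
    set x := Real.log n with hx
    set y := Real.log (n + 1 : ℕ) with hy
    have hx0 : 0 ≤ x := Real.log_nonneg hn'
    have hxy : 1 / ((n + 1 : ℕ) : ℝ) ≤ y - x := by
      have h := Real.one_sub_inv_le_log_of_pos (x := (n + 1 : ℕ) / (n : ℝ)) (by positivity)
      rw [Real.log_div (by positivity) (by positivity)] at h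
      refine le_trans (le_of_eq ?_) h
      push_cast
      field_simp
      ring
    have hq : 0 < 1 / ((n + 1 : ℕ) : ℝ) := by positivity
    have hceil : (⌈y / l⌉₊ : ℝ) ≤ y / l + 1 :=
      (Nat.ceil_lt_add_one (div_nonneg (by linarith) hl.le)).le
    have h1 : (⌈y / l⌉₊ : ℝ) / (n + 1 : ℕ) ≤ (y ^ 2 - x ^ 2 + 2 * (y - x)) / l := by
      calc (⌈y / l⌉₊ : ℝ) / (n + 1 : ℕ) = ⌈y / l⌉₊ * (1 / (n + 1 : ℕ)) := by ring
        _ ≤ (y / l + 1) * (y - x) :=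
            mul_le_mul hceil hxy hq.le (add_nonneg (div_nonneg (by linarith) hl.le) zero_le_one)
        _ = ((y + l) * (y - x)) / l := by field_simp
        _ ≤ (y ^ 2 - x ^ 2 + 2 * (y - x)) / l := by
            refine div_le_div_of_nonneg_right ?_ hl.le
            nlinarith
    have h2 : (y ^ 2 + 2 * y) / l = (x ^ 2 + 2 * x) / l + (y ^ 2 - x ^ 2 + 2 * (y - x)) / l := by
      ring
    rw [h2]
    linarith

/-- With `u = ln(τ/n)` one has `n/τ ≥ 1 - u`, which leaves a surplus `2u - u²`. This suffices for `u
≤ 2`; for larger `u` the square alone suffices. -/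
theorem sq_add_log_le {n τ : ℝ} (hn : 1 ≤ n) (hnτ : n ≤ τ) :
    Real.log n ^ 2 + 2 * Real.log n ≤ Real.log τ ^ 2 + 2 * Real.log τ * (n / τ) := by
  set x := Real.log n with hx
  set u := Real.log τ - x with hu
  have hx0 : 0 ≤ x := Real.log_nonneg hn
  have hu0 : 0 ≤ u := sub_nonneg.2 (Real.log_le_log (by linarith) hnτ)
  have hy : Real.log τ = x + u := by rw [hu]; ring
  have hr : 1 - u ≤ n / τ := by
    have h := Real.log_le_sub_one_of_pos (x := n / τ) (div_pos (by linarith) (by linarith))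
    rw [Real.log_div (by linarith) (by linarith)] at h
    linarith
  have hr0 : 0 ≤ n / τ := div_nonneg (by linarith) (by linarith)
  rw [hy]
  rcases le_total u 2 with h2 | h2
  · nlinarith [mul_le_mul_of_nonneg_left hr (by linarith : 0 ≤ 2 * (x + u))]
  · nlinarith [mul_nonneg (by linarith : 0 ≤ 2 * (x + u)) hr0]

theorem sum_ceil_log_min_le {l : ℝ} (hl : 0 < l) (hl2 : l ≤ 2) {n τ : ℕ} (hn : 1 ≤ n)
    (hτ : 1 ≤ τ) :
    ∑ t ∈ Finset.range n, (⌈Real.log (min (t + 1) τ : ℕ) / l⌉₊ : ℝ) / (min (t + 1) τ : ℕ)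
      ≤ Real.log τ ^ 2 / l + 2 * ⌈Real.log τ / l⌉₊ * (n / τ) := by
  have hτ' : (1 : ℝ) ≤ τ := by exact_mod_cast hτ
  have key : ∀ m : ℕ, 1 ≤ m → m ≤ τ →
      ∑ t ∈ Finset.range m, (⌈Real.log (min (t + 1) τ : ℕ) / l⌉₊ : ℝ) / (min (t + 1) τ : ℕ)
      ≤ Real.log τ ^ 2 / l + 2 * ⌈Real.log τ / l⌉₊ * (m / τ) := by
    intro m hm hmτ
    have h1 : ∑ t ∈ Finset.range m,
        (⌈Real.log (min (t + 1) τ : ℕ) / l⌉₊ : ℝ) / (min (t + 1) τ : ℕ)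
        = ∑ t ∈ Finset.range m, (⌈Real.log (t + 1 : ℕ) / l⌉₊ : ℝ) / (t + 1 : ℕ) := by
      refine Finset.sum_congr rfl fun t ht => ?_
      have := Finset.mem_range.1 ht
      rw [min_eq_left (by omega)]
    rw [h1]
    refine (sum_ceil_log_div_le hl hl2 m).trans ?_
    have h2 := sq_add_log_le (n := m) (τ := τ) (by exact_mod_cast hm) (by exact_mod_cast hmτ)
    have h3 := Nat.le_ceil (Real.log τ / l)
    calc (Real.log m ^ 2 + 2 * Real.log m) / l
        ≤ (Real.log τ ^ 2 + 2 * Real.log τ * (m / τ)) / l :=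
          div_le_div_of_nonneg_right h2 hl.le
      _ = Real.log τ ^ 2 / l + 2 * (Real.log τ / l) * (m / τ) := by ring
      _ ≤ _ := by gcongr
  rcases le_total n τ with h | h
  · exact key n hn h
  · obtain ⟨d, rfl⟩ := Nat.exists_eq_add_of_le h
    rw [Finset.sum_range_add]
    have h1 := key τ hτ le_rfl
    have h2 : ∑ x ∈ Finset.range d,
        (⌈Real.log (min (τ + x + 1) τ : ℕ) / l⌉₊ : ℝ) / (min (τ + x + 1) τ : ℕ)
        = d * (⌈Real.log τ / l⌉₊ / τ) := by
      rw [← nsmul_eq_mul, ← Finset.card_range d, ← Finset.sum_const, Finset.card_range]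
      refine Finset.sum_congr rfl fun t _ => ?_
      rw [min_eq_right (by omega)]
    -- The rounds after `τ` cost this amount once, while the bound allows it twice.
    have h4 : 0 ≤ (d : ℝ) * (⌈Real.log τ / l⌉₊ / τ) := by positivity
    have h5 : 2 * (⌈Real.log τ / l⌉₊ : ℝ) * ((τ + d : ℕ) / τ)
        = 2 * ⌈Real.log τ / l⌉₊ * (τ / τ) + 2 * (d * (⌈Real.log τ / l⌉₊ / τ)) := by
      push_cast
      ring
    rw [h2, h5]
    linarith

end Logarithms

/-! ### Regret of a round and the bound for every window size -/

section Environment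

variable {L K : ℕ}

open scoped Classical in
/-- Each change of the means affects at most `τ` windows. -/
theorem sum_nonstationary_le (α : ℕ → Fin L → ℝ) (n τ : ℕ) :
    ∑ t ∈ Finset.range n, (if ∀ r < t, t ≤ r + τ → α r = α t then (0 : ℝ) else 1)
      ≤ numChanges α n * τ := by
  have h1 : ∑ t ∈ Finset.range n, (if ∀ r < t, t ≤ r + τ → α r = α t then (0 : ℝ) else 1)
      = ((Finset.range n).filter fun t => ¬ ∀ r < t, t ≤ r + τ → α r = α t).card := by
    rw [Finset.card_filter]
    push_cast
    refine Finset.sum_congr rfl fun t _ => ?_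
    by_cases h : ∀ r < t, t ≤ r + τ → α r = α t
    · rw [if_pos h, if_neg (not_not.2 h)]
    · rw [if_neg h, if_pos h]
  rw [h1, numChanges]
  norm_cast
  set S := (Finset.range n).filter (fun t => t + 1 < n ∧ α (t + 1) ≠ α t) with hS
  have h2 : ((Finset.range n).filter fun t => ¬ ∀ r < t, t ≤ r + τ → α r = α t)
      ⊆ S.biUnion fun q => Finset.Ioc q (q + τ) := by
    intro t ht
    obtain ⟨htn, ht⟩ := Finset.mem_filter.1 ht
    have htn := Finset.mem_range.1 htn
    push Not at ht
    obtain ⟨r, hr, hrτ, hne⟩ := ht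
    -- If the means differ between `r` and `t`, a change occurs at some `q` in between, and then `q
    -- < t ≤ q + τ`.
    obtain ⟨q, hq1, hq2, hq3⟩ : ∃ q, r ≤ q ∧ q < t ∧ α (q + 1) ≠ α q := by
      by_contra hcon
      push Not at hcon
      have : ∀ m, r ≤ m → m ≤ t → α m = α r := by
        intro m hm
        induction m, hm using Nat.le_induction with
        | base => intro _; rfl
        | succ m hm ih => intro hmt; rw [hcon m hm hmt, ih (by omega)]
      exact hne (this t hr.le le_rfl).symm
    refine Finset.mem_biUnion.2 ⟨q, ?_, Finset.mem_Ioc.2 ⟨hq2, by omega⟩⟩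
    exact Finset.mem_filter.2 ⟨Finset.mem_range.2 (by omega), by omega, hq3⟩
  refine (Finset.card_le_card h2).trans (Finset.card_biUnion_le_card_mul _ _ _ fun q _ => ?_)
  simp

theorem numChanges_lt {α : ℕ → Fin L → ℝ} {n : ℕ} (hn : 1 ≤ n) : numChanges α n + 1 ≤ n := by
  classical
  have : numChanges α n ≤ (Finset.range (n - 1)).card := by
    refine Finset.card_le_card fun t ht => ?_
    have := (Finset.mem_filter.1 ht).2.1
    exact Finset.mem_range.2 (by omega)
  rw [Finset.card_range] at this
  omega

theorem gap_le {α : ℕ → Fin L → ℝ} {D : ℕ → Finset (Fin L)} {n t : ℕ}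
    (hα : ∀ t < n, ∀ a, α t a ∈ Set.Icc (0 : ℝ) 1) (ht : t < n) {a b : Fin L} (ha : a ∉ D t)
    (hb : b ∈ D t) : gap α D n a ≤ α t b - α t a := by
  refine csInf_le ⟨-1, ?_⟩ ⟨t, ht, ha, b, hb, rfl⟩
  rintro x ⟨s, hs, -, c, -, rfl⟩
  linarith [(hα s hs c).1, (hα s hs a).2]

/-- If all confidence bounds hold, then the gaps of the displayed suboptimal items are small. -/
theorem sub_le_penalty {ε : ℝ} (hε : ε ∈ Set.Ioo (1 / 2 : ℝ) 1) {τ : ℕ} (hτ : 2 ≤ τ)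
    {v : Fin L → ℝ} (hv : ∀ a, v a ∈ Set.Icc (0 : ℝ) 1) {h : History L K} {a b : Fin L} {Δ : ℝ}
    (hΔ : 0 < Δ) (hgap : Δ ≤ v b - v a) (hucb : ucb ε τ h b ≤ ucb ε τ h a)
    (ha : ¬ Deviates ε τ 1 (v a) a h) (hb : ¬ Deviates ε τ (-1) (v b) b h) :
    v b - v a ≤ penalty (ε * Real.log τ) Δ (obsCount τ h a) := by
  have hε0 : 0 < ε := by linarith [hε.1]
  have hτ' : (2 : ℝ) ≤ τ := by exact_mod_cast hτ
  have hlog2 := Real.log_two_gt_d9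
  have hlogτ : Real.log 2 ≤ Real.log τ := Real.log_le_log (by norm_num) hτ'
  set c := ε * Real.log τ with hc
  have hc4 : 1 / 4 ≤ c := by rw [hc]; nlinarith [hε.1]
  rcases Nat.eq_zero_or_pos (obsCount τ h a) with h0 | hpos
  -- An unobserved item pays `2√c ≥ 1`, which covers any gap; this is where `ε > 1/2` and `τ ≥ 2`
  -- give `c ≥ 1/4`.
  · rw [h0, penalty, if_pos (by simp; linarith)]
    have h1 : 1 / 2 ≤ √c := Real.le_sqrt_of_sq_le (by linarith)
    simp only [zero_le, max_eq_right, Nat.cast_one, Real.sqrt_one, div_one]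
    linarith [(hv b).2, (hv a).1]
  · set T := effWindow τ h with hT
    have hT1 : (1 : ℝ) ≤ T := by
      have : 1 ≤ T := by rw [hT]; unfold effWindow; omega
      exact_mod_cast this
    have hTτ : (T : ℝ) ≤ τ := by
      have : T ≤ τ := by rw [hT]; unfold effWindow; omega
      exact_mod_cast this
    have hlogT : 0 ≤ Real.log T := Real.log_nonneg hT1
    set d := √(ε * Real.log T) with hd
    have hdc : d ≤ √c := by
      rw [hd, hc]
      gcongr
    have hucb_eq : ∀ i, 0 < obsCount τ h i →
        ucb ε τ h i = clickCount τ h i / obsCount τ h i + d / √(obsCount τ h i) := by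
      intro i hi
      rw [ucb, divOne, divOne, if_neg hi.ne', if_neg hi.ne', Real.sqrt_div' _ (by positivity)]
      rfl
    set N : ℝ := ((obsCount τ h a : ℕ) : ℝ) with hN
    have hN0 : 0 < N := by rw [hN]; exact_mod_cast hpos
    have hsN : 0 < √N := Real.sqrt_pos.2 hN0
    have hsN2 : √N * √N = N := Real.mul_self_sqrt hN0.le
    have h1 : ucb ε τ h a ≤ v a + 2 * d / √N := by
      have h2 : ¬ d * √N ≤ 1 * (clickCount τ h a - v a * N) := fun h' => ha ⟨hpos, h'⟩
      push Not at h2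
      rw [hucb_eq a hpos]
      have h3 : (clickCount τ h a : ℝ) / N ≤ v a + d / √N := by
        have h4 : d / √N * N = d * √N := by
          rw [div_mul_eq_mul_div, div_eq_iff hsN.ne', mul_assoc, hsN2]
        rw [div_le_iff₀ hN0, add_mul, h4]
        linarith
      have h5 : 2 * d / √N = d / √N + d / √N := by ring
      linarith
    have h2 : v b ≤ ucb ε τ h b := by
      rcases Nat.eq_zero_or_pos (obsCount τ h b) with h0 | hposb
      -- By the convention `x / 0 = 1` the index of an unobserved item is 2.
      · rw [ucb, divOne, divOne, if_pos h0, if_pos h0, Real.sqrt_one]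
        linarith [(hv b).2]
      · have h2 : ¬ d * √(obsCount τ h b)
            ≤ -1 * (clickCount τ h b - v b * obsCount τ h b) := fun h' => hb ⟨hposb, h'⟩
        push Not at h2
        rw [hucb_eq b hposb]
        set M : ℝ := ((obsCount τ h b : ℕ) : ℝ) with hM
        have hM0 : 0 < M := by rw [hM]; exact_mod_cast hposb
        have hsM : 0 < √M := Real.sqrt_pos.2 hM0
        have hsM2 : √M * √M = M := Real.mul_self_sqrt hM0.le
        have h4 : d / √M = d * √M / M := by
          rw [div_eq_div_iff hsM.ne' hM0.ne', mul_assoc, hsM2]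
        rw [h4, ← add_div, le_div_iff₀ hM0]
        linarith
    have h3 : v b - v a ≤ 2 * √c / √N := by
      have : 2 * d / √N ≤ 2 * √c / √N := by gcongr
      linarith
    have h4 : Δ ^ 2 * N ≤ 4 * c := by
      have h5 : Δ * √N ≤ 2 * √c := (le_div_iff₀ hsN).1 (hgap.trans h3)
      have h6 : (Δ * √N) ^ 2 ≤ (2 * √c) ^ 2 := by gcongr
      rw [mul_pow, mul_pow, Real.sq_sqrt hN0.le, Real.sq_sqrt (by linarith)] at h6
      linarith
    rw [penalty, if_pos h4, max_eq_left hpos]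
    exact h3

open scoped Classical in
/-- The regret of a list in a round, given the history. -/
theorem iSup_reward_sub_le_of_isCascadeSWUCB {ε : ℝ} (hε : ε ∈ Set.Ioo (1 / 2 : ℝ) 1) {τ : ℕ}
    (hτ : 2 ≤ τ) {σ : History L K → Ranking L K} (hσ : IsCascadeSWUCB ε τ σ)
    {v : Fin L → ℝ} (hv : ∀ a, v a ∈ Set.Icc (0 : ℝ) 1)
    {D : Finset (Fin L)} (hD : D.card = K) (hopt : ∀ b ∈ D, ∀ a ∉ D, v a ≤ v b)
    {Δ : Fin L → ℝ} (hΔ : ∀ a ∉ D, 0 < Δ a) (hgap : ∀ a ∉ D, ∀ b ∈ D, Δ a ≤ v b - v a)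
    (h : History L K) :
    (⨆ R : Ranking L K, reward R v) - reward (σ h) v
      ≤ ∑ a, (if Deviates ε τ (if a ∈ D then -1 else 1) (v a) a h then (1 : ℝ) else 0)
        + ∑ a, (if a ∈ D then 0 else
          ∑ y, rowWeight v y * (if Observed (σ h, click (σ h) y) a then
            penalty (ε * Real.log τ) (Δ a) (obsCount τ h a) else 0)) := by
  set φ : Fin L → ℝ := fun a => penalty (ε * Real.log τ) (Δ a) (obsCount τ h a) with hφ
  have hφ0 : ∀ a, 0 ≤ φ a := fun a => penalty_nonneg _ _ _
  set g : Fin L → ℝ := fun a => if a ∈ D then 0 else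
    ∑ y, rowWeight v y * (if Observed (σ h, click (σ h) y) a then φ a else 0) with hg
  have hg0 : ∀ a, 0 ≤ g a := by
    intro a
    simp only [hg]
    split_ifs
    · exact le_rfl
    · refine Finset.sum_nonneg fun y _ => mul_nonneg (rowWeight_nonneg hv y) ?_
      split_ifs
      · exact hφ0 a
      · exact le_rfl
  -- A bound can fail harmlessly in one direction: only underestimation of optimal items and
  -- overestimation of the others matter. A harmful failure costs at most 1, which the indicator of
  -- the failing item pays.
  by_cases hbad : ∃ a, Deviates ε τ (if a ∈ D then -1 else 1) (v a) a h
  · obtain ⟨a, ha⟩ := hbad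
    have h1 : (1 : ℝ) ≤
        ∑ a, (if Deviates ε τ (if a ∈ D then -1 else 1) (v a) a h then (1 : ℝ) else 0) := by
      refine le_trans ?_ (Finset.single_le_sum (fun i _ => ?_) (Finset.mem_univ a))
      · rw [if_pos ha]
      · split_ifs <;> norm_num
    have : Nonempty (Ranking L K) := ⟨σ h⟩
    have h2 : (⨆ R : Ranking L K, reward R v) ≤ 1 := ciSup_le fun R => (reward_mem_Icc hv R).2
    have h3 := (reward_mem_Icc hv (σ h)).1
    have h4 : 0 ≤ ∑ a, g a := Finset.sum_nonneg fun a _ => hg0 a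
    linarith
  · push Not at hbad
    have h1 := iSup_reward_sub_le hv hD hopt (σ h) φ fun a haR haD b hbD hbR => by
      have h2 := hbad a
      have h3 := hbad b
      rw [if_neg haD] at h2
      rw [if_pos hbD] at h3
      exact sub_le_penalty hε hτ hv (hΔ a haD) (hgap a haD b hbD) (hσ h a haR b hbR) h2 h3
    have h2 : ∀ k, (∏ i ∈ Finset.Iio k, (1 - v (σ h i))) * (if σ h k ∈ D then 0 else φ (σ h k))
        = g (σ h k) := by
      intro k
      rw [← sum_rowWeight_le_click, Finset.sum_mul]
      simp only [hg]
      split_ifs with hk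
      · simp
      · refine Finset.sum_congr rfl fun y _ => ?_
        rw [observed_iff]
        split_ifs <;> simp
    simp only [h2] at h1
    have h3 : ∑ k, g (σ h k) ≤ ∑ a, g a := by
      rw [← Finset.sum_map Finset.univ (σ h) g]
      exact Finset.sum_le_sum_of_subset_of_nonneg (Finset.subset_univ _) fun a _ _ => hg0 a
    have h4 : 0 ≤
        ∑ a, (if Deviates ε τ (if a ∈ D then -1 else 1) (v a) a h then (1 : ℝ) else 0) :=
      Finset.sum_nonneg fun a _ => by split_ifs <;> norm_num
    linarith

variable {Ω : Type*} [MeasurableSpace Ω] {μ : Measure Ω} [IsProbabilityMeasure μ]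
  {n : ℕ} {α : ℕ → Fin L → ℝ} {A : ℕ → Fin L → Ω → Bool}

/-- The list is fixed by the history, so averaging over the fresh row replaces the realised reward
by its mean. -/
theorem IsEnvironment.integral_regret_eq (hA : IsEnvironment μ n α A)
    (σ : History L K → Ranking L K) {t : ℕ} (ht : t < n) (c : ℝ) :
    ∫ ω, (c - reward (σ (history σ (fun s a => A s a ω) t))
        (fun a => if A t a ω = true then 1 else 0)) ∂μ
      = ∫ ω, (c - reward (σ (history σ (fun s a => A s a ω) t)) (α t)) ∂μ := by
  rw [hA.integral_history_row σ ht
    (fun h y => c - reward (σ h) (fun a => if y a = true then 1 else 0))]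
  simp only [mul_sub, Finset.sum_sub_distrib, ← Finset.sum_mul, sum_rowWeight, one_mul,
    sum_rowWeight_mul_reward]

open scoped Classical in
/-- The expected regret of a single round. -/
theorem IsEnvironment.integral_regret_le (hA : IsEnvironment μ n α A) {ε : ℝ}
    (hε : ε ∈ Set.Ioo (1 / 2 : ℝ) 1) {τ : ℕ} (hτ : 2 ≤ τ) {σ : History L K → Ranking L K}
    (hσ : IsCascadeSWUCB ε τ σ) {D : ℕ → Finset (Fin L)} (hD : IsOptimalSets K n α D)
    (hgap : ∀ a, (∃ t < n, a ∉ D t) → 0 < gap α D n a) {t : ℕ} (ht : t < n) :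
    ∫ ω, ((⨆ R : Ranking L K, reward R (α t)) - reward (σ (history σ (fun s a => A s a ω) t))
        (fun a => if A t a ω = true then 1 else 0)) ∂μ
      ≤ (if ∀ r < t, t ≤ r + τ → α r = α t then (0 : ℝ) else 1)
        + L * (⌈Real.log (min (t + 1) τ : ℕ) / logEta ε⌉₊ / (min (t + 1) τ : ℕ))
        + ∑ a, (if a ∈ D t then 0 else
          ∫ ω, (if Observed (σ (history σ (fun s a => A s a ω) t),
              click (σ (history σ (fun s a => A s a ω) t)) (fun a => A t a ω)) a then
            penalty (ε * Real.log τ) (gap α D n a)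
              (obsCount τ (history σ (fun s a => A s a ω) t) a) else 0) ∂μ) := by
  have hv : ∀ a, α t a ∈ Set.Icc (0 : ℝ) 1 := hA.mem_Icc ht
  set P : Fin L → History L K → (Fin L → Bool) → ℝ := fun a h y =>
    if Observed (σ h, click (σ h) y) a then
      penalty (ε * Real.log τ) (gap α D n a) (obsCount τ h a) else 0 with hP
  have hP0 : ∀ a h y, 0 ≤ P a h y := fun a h y => by
    simp only [hP]; split_ifs
    · exact penalty_nonneg _ _ _
    · exact le_rfl
  have hpen : 0 ≤ ∑ a, (if a ∈ D t then 0 else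
      ∫ ω, P a (history σ (fun s a => A s a ω) t) (fun a => A t a ω) ∂μ) := by
    refine Finset.sum_nonneg fun a _ => ?_
    split_ifs
    · exact le_rfl
    · exact integral_nonneg fun ω => hP0 _ _ _
  rw [hA.integral_regret_eq σ ht]
  split_ifs with hstat
  · rw [zero_add]
    set dev : Fin L → History L K → ℝ := fun a h =>
      if Deviates ε τ (if a ∈ D t then -1 else 1) (α t a) a h then (1 : ℝ) else 0 with hdev
    set pen : Fin L → History L K → ℝ := fun a h =>
      if a ∈ D t then 0 else ∑ y, rowWeight (α t) y * P a h y with hpen_def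
    have hi1 : ∀ a, Integrable (fun ω => dev a (history σ (fun s a => A s a ω) t)) μ :=
      fun a => hA.integrable_history σ ht.le (dev a)
    have hi2 : ∀ a, Integrable (fun ω => pen a (history σ (fun s a => A s a ω) t)) μ :=
      fun a => hA.integrable_history σ ht.le (pen a)
    have h1 : ∫ ω, ((⨆ R : Ranking L K, reward R (α t))
          - reward (σ (history σ (fun s a => A s a ω) t)) (α t)) ∂μ
        ≤ ∫ ω, (∑ a, dev a (history σ (fun s a => A s a ω) t)
          + ∑ a, pen a (history σ (fun s a => A s a ω) t)) ∂μ := by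
      refine integral_mono (hA.integrable_history σ ht.le fun h =>
        (⨆ R : Ranking L K, reward R (α t)) - reward (σ h) (α t))
        ((integrable_finsetSum _ fun a _ => hi1 a).add (integrable_finsetSum _ fun a _ => hi2 a))
        fun ω => ?_
      exact iSup_reward_sub_le_of_isCascadeSWUCB hε hτ hσ hv (hD t ht).1 (hD t ht).2
        (fun a ha => hgap a ⟨t, ht, ha⟩) (fun a ha b hb => gap_le (fun s hs => hA.mem_Icc hs)
          ht ha hb) _
    rw [integral_add (integrable_finsetSum _ fun a _ => hi1 a)
      (integrable_finsetSum _ fun a _ => hi2 a), integral_finsetSum _ fun a _ => hi1 a,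
      integral_finsetSum _ fun a _ => hi2 a] at h1
    refine h1.trans (add_le_add ?_ (Finset.sum_le_sum fun a _ => ?_))
    · refine (Finset.sum_le_card_nsmul _ _
        (⌈Real.log (min (t + 1) τ : ℕ) / logEta ε⌉₊ / (min (t + 1) τ : ℕ) : ℝ)
        fun a _ => ?_).trans (le_of_eq (by simp))
      refine hA.integral_deviates_le σ hε hτ ?_ (α t a) a ht.le
        fun r hr hr' => congrFun (hstat r hr hr') a
      split_ifs <;> norm_num
    · simp only [hpen_def]
      split_ifs
      · simp
      · rw [hA.integral_history_row σ ht (P a)]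
  · have : Nonempty (Ranking L K) := ⟨σ []⟩
    have h1 : ∫ ω, ((⨆ R : Ranking L K, reward R (α t))
        - reward (σ (history σ (fun s a => A s a ω) t)) (α t)) ∂μ ≤ ∫ _, (1 : ℝ) ∂μ := by
      refine integral_mono (hA.integrable_history σ ht.le fun h =>
        (⨆ R : Ranking L K, reward R (α t)) - reward (σ h) (α t)) (integrable_const _)
        fun ω => ?_
      have h2 : (⨆ R : Ranking L K, reward R (α t)) ≤ 1 :=
        ciSup_le fun R => (reward_mem_Icc hv R).2
      have h3 := (reward_mem_Icc hv (σ (history σ (fun s a => A s a ω) t))).1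
      beta_reduce
      linarith
    simp only [integral_const, probReal_univ, smul_eq_mul, mul_one] at h1
    have h2 : 0 ≤ (L : ℝ) *
        (⌈Real.log (min (t + 1) τ : ℕ) / logEta ε⌉₊ / (min (t + 1) τ : ℕ)) := by positivity
    linarith

/-- The regret bound of CascadeSWUCB for an arbitrary window size. -/
theorem IsEnvironment.regret_le (hA : IsEnvironment μ n α A) (hK : 1 ≤ K) {ε : ℝ}
    (hε : ε ∈ Set.Ioo (1 / 2 : ℝ) 1) (hn : 1 ≤ n) {τ : ℕ} (hτ : 2 ≤ τ)
    {σ : History L K → Ranking L K} (hσ : IsCascadeSWUCB ε τ σ) {D : ℕ → Finset (Fin L)}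
    (hD : IsOptimalSets K n α D) (hgap : ∀ a, (∃ t < n, a ∉ D t) → 0 < gap α D n a) :
    regret μ α A σ n ≤
      L * numChanges α n * τ + L * Real.log τ ^ 2 / logEta ε
        + ∑ a, swConst ε n τ (invGap α D n a) * (n * Real.log τ / τ) := by
  classical
  have hl := logEta_pos hε
  have hτ' : (2 : ℝ) ≤ τ := by exact_mod_cast hτ
  have hn' : (1 : ℝ) ≤ n := by exact_mod_cast hn
  have hlogτ : 0 < Real.log τ := Real.log_pos (by linarith)
  have hL : (1 : ℝ) ≤ L := by
    have h1 := Fintype.card_le_of_embedding (σ [])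
    simp only [Fintype.card_fin] at h1
    exact_mod_cast hK.trans h1
  set c := ε * Real.log τ with hc
  have hc4 : 1 / 4 ≤ c := by
    have h1 := Real.log_two_gt_d9
    have h2 : Real.log 2 ≤ Real.log τ := Real.log_le_log (by norm_num) hτ'
    rw [hc]; nlinarith [hε.1]
  set P : ℕ → Fin L → Ω → ℝ := fun t a ω =>
    if Observed (σ (history σ (fun s a => A s a ω) t),
        click (σ (history σ (fun s a => A s a ω) t)) (fun a => A t a ω)) a then
      penalty c (gap α D n a) (obsCount τ (history σ (fun s a => A s a ω) t) a) else 0 with hP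
  have hP0 : ∀ t a ω, 0 ≤ P t a ω := fun t a ω => by
    simp only [hP]; split_ifs
    · exact penalty_nonneg _ _ _
    · exact le_rfl
  have hPi : ∀ t < n, ∀ a, Integrable (P t a) μ := fun t ht a =>
    hA.integrable_history_row σ ht fun h y => if Observed (σ h, click (σ h) y) a then
      penalty c (gap α D n a) (obsCount τ h a) else 0
  have hitem : ∀ a, ∑ t ∈ Finset.range n, (if a ∈ D t then 0 else ∫ ω, P t a ω ∂μ)
      ≤ ⌈(n : ℝ) / τ⌉ * (8 * c * invGap α D n a) := by
    intro a
    by_cases ha : ∃ t < n, a ∉ D t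
    · have hΔ1 : gap α D n a ≤ 1 := by
        obtain ⟨t, ht, hat⟩ := ha
        obtain ⟨b, hb⟩ : (D t).Nonempty := Finset.card_pos.1 (by rw [(hD t ht).1]; exact hK)
        have h1 := gap_le (fun s hs => hA.mem_Icc hs) ht hat hb
        linarith [(hA.mem_Icc ht b).2, (hA.mem_Icc ht a).1]
      rw [invGap, if_pos ha, mul_one_div]
      -- Rounds in which `a` is optimal are put back, so that the pathwise bound on all observations
      -- of `a` applies.
      calc ∑ t ∈ Finset.range n, (if a ∈ D t then 0 else ∫ ω, P t a ω ∂μ)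
          ≤ ∑ t ∈ Finset.range n, ∫ ω, P t a ω ∂μ := by
            refine Finset.sum_le_sum fun t _ => ?_
            split_ifs
            · exact integral_nonneg (hP0 t a)
            · exact le_rfl
        _ = ∫ ω, ∑ t ∈ Finset.range n, P t a ω ∂μ :=
            (integral_finsetSum _ fun t ht => hPi t (Finset.mem_range.1 ht) a).symm
        _ ≤ ∫ _, ⌈(n : ℝ) / τ⌉ * (8 * c / gap α D n a) ∂μ := by
            refine integral_mono (integrable_finsetSum _ fun t ht =>
              hPi t (Finset.mem_range.1 ht) a) (integrable_const _) fun ω => ?_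
            exact sum_observed_penalty_le σ (fun s a => A s a ω) a hc4 (hgap a ha) hΔ1
              (by omega) n
        _ = ⌈(n : ℝ) / τ⌉ * (8 * c / gap α D n a) := by simp
    · push Not at ha
      have h0 : invGap α D n a = 0 := if_neg (by push Not; exact ha)
      rw [h0, mul_zero, mul_zero]
      exact (Finset.sum_eq_zero fun t ht => if_pos (ha t (Finset.mem_range.1 ht))).le
  have hsum := sum_ceil_log_min_le hl (logEta_le_two hε) hn (by omega : 1 ≤ τ)
  have hchange := sum_nonstationary_le α n τ
  have h1 : regret μ α A σ n ≤
      ∑ t ∈ Finset.range n, (if ∀ r < t, t ≤ r + τ → α r = α t then (0 : ℝ) else 1)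
      + L * ∑ t ∈ Finset.range n,
        (⌈Real.log (min (t + 1) τ : ℕ) / logEta ε⌉₊ : ℝ) / (min (t + 1) τ : ℕ)
      + ∑ a, ∑ t ∈ Finset.range n, (if a ∈ D t then 0 else ∫ ω, P t a ω ∂μ) := by
    rw [Finset.sum_comm, Finset.mul_sum, ← Finset.sum_add_distrib, ← Finset.sum_add_distrib]
    refine Finset.sum_le_sum fun t ht => ?_
    exact hA.integral_regret_le hε hτ hσ hD hgap (Finset.mem_range.1 ht)
  have h2 : ∀ a, swConst ε n τ (invGap α D n a) * (n * Real.log τ / τ)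
      = 2 * ⌈Real.log τ / logEta ε⌉₊ * (n / τ)
        + ⌈(n : ℝ) / τ⌉ * (8 * c * invGap α D n a) := by
    intro a
    have e : ((⌈Real.log τ / logEta ε⌉₊ : ℕ) : ℝ) = (⌈Real.log τ / logEta ε⌉ : ℝ) :=
      natCast_ceil_eq_intCast_ceil (by positivity)
    rw [swConst, e, hc]
    field_simp
  simp only [h2]
  rw [Finset.sum_add_distrib, Finset.sum_const, Finset.card_univ, Fintype.card_fin, nsmul_eq_mul]
  have h3 := Finset.sum_le_sum fun a (_ : a ∈ Finset.univ) => hitem a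
  have h4 := mul_le_mul_of_nonneg_left hsum (by linarith : (0 : ℝ) ≤ L)
  -- A spoiled round is charged once and not once per item, so the factor `L` is slack here.
  have h5 : (numChanges α n * τ : ℝ) ≤ L * numChanges α n * τ := by
    rw [mul_assoc]
    exact le_mul_of_one_le_left (by positivity) hL
  rw [mul_add, ← mul_div_assoc] at h4
  linarith

end Environment

/-! ### Limit of the constant and the tuned window -/

section Rates

theorem tendsto_swConst {ε : ℝ} (hε : ε ∈ Set.Ioo (1 / 2 : ℝ) 1) {n τ : ℕ → ℕ} {g : ℕ → ℝ}
    {g₀ : ℝ} (hτ : Tendsto τ atTop atTop)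
    (hnτ : Tendsto (fun k => (n k : ℝ) / τ k) atTop atTop) (hg : Tendsto g atTop (𝓝 g₀)) :
    Tendsto (fun k => swConst ε (n k) (τ k) (g k)) atTop (𝓝 (2 / logEta ε + 8 * ε * g₀)) := by
  have hl := logEta_pos hε
  have hceil : Tendsto (fun x : ℝ => (⌈x⌉ : ℝ) / x) atTop (𝓝 1) := by
    refine (tendsto_nat_ceil_div_atTop (R := ℝ)).congr' ?_
    filter_upwards [eventually_ge_atTop 0] with x hx
    rw [natCast_ceil_eq_intCast_ceil hx]
  have hlog : Tendsto (fun k => Real.log (τ k) / logEta ε) atTop atTop :=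
    (Real.tendsto_log_atTop.comp (tendsto_natCast_atTop_atTop.comp hτ)).atTop_div_const hl
  -- The first summand is `(2/λ) · ⌈y⌉/y` with `y = ln τ / λ`.
  have h1 := (hceil.comp hlog).const_mul (2 / logEta ε)
  have h2 := (hg.const_mul (8 * ε)).mul (hceil.comp hnτ)
  rw [mul_one] at h1 h2
  refine (h1.add h2).congr fun k => ?_
  simp only [Function.comp_apply, swConst]
  congr 1
  rw [div_div_eq_mul_div]
  field_simp

/-- From `ln³x / 6 ≤ x` follows `ln⁴x ≤ 6 x ln x ≤ 9 s²`. This shows that the `ln²τ` term does not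
exceed the rate. -/
theorem log_sq_le_of_mul_log_le {x s : ℝ} (hx : 1 ≤ x) (hs : 0 ≤ s) (h : x * Real.log x ≤ s ^ 2) :
    Real.log x ^ 2 ≤ 3 * s := by
  have h0 : 0 ≤ Real.log x := Real.log_nonneg hx
  have h1 := Real.pow_div_factorial_le_exp (Real.log x) h0 3
  rw [Real.exp_log (by linarith)] at h1
  norm_num [Nat.factorial] at h1
  refine abs_le_of_sq_le_sq' ?_ (by positivity) |>.2
  nlinarith [mul_le_mul_of_nonneg_right h1 h0]

/-- The window size `2 √(n ln n / Υ)`, up to rounding. -/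
theorem tuned_window_bounds {n τ Υ : ℕ} (hΥ : 1 ≤ Υ) (hΥn : Υ + 1 ≤ n)
    (hτ : |(τ : ℝ) - 2 * √(n * Real.log n / Υ)| < 1) :
    2 ≤ τ ∧ (Υ : ℝ) * τ ≤ 3 * √(n * Υ * Real.log n) ∧
      Real.log τ ^ 2 ≤ 27 * √(n * Υ * Real.log n) ∧
      n * Real.log τ / τ ≤ 3 * √(n * Υ * Real.log n) ∧ (τ : ℝ) ≤ 3 * n := by
  have hΥ' : (1 : ℝ) ≤ Υ := by exact_mod_cast hΥ
  have hn2 : (2 : ℝ) ≤ n := by exact_mod_cast (by omega : 2 ≤ n)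
  have hΥn' : (Υ : ℝ) ≤ n - 1 := by
    have : ((Υ + 1 : ℕ) : ℝ) ≤ n := by exact_mod_cast hΥn
    push_cast at this
    linarith
  have hlog : 1 - (n : ℝ)⁻¹ ≤ Real.log n := Real.one_sub_inv_le_log_of_pos (by linarith)
  have hlogn : (n : ℝ) - 1 ≤ n * Real.log n := by
    have := mul_le_mul_of_nonneg_left hlog (by linarith : (0 : ℝ) ≤ n)
    rwa [mul_sub, mul_one, mul_inv_cancel₀ (by linarith)] at this
  have hlog0 : 0 ≤ Real.log n := Real.log_nonneg (by linarith)
  have hlogle : Real.log n ≤ n := (Real.log_le_sub_one_of_pos (by linarith)).trans (by linarith)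
  set q := √(n * Real.log n / Υ) with hq
  have hx1 : 1 ≤ n * Real.log n / Υ := by rw [one_le_div (by linarith)]; linarith
  have hq1 : 1 ≤ q := Real.one_le_sqrt.2 hx1
  have hq2 : q ^ 2 * Υ = n * Real.log n := by
    rw [hq, Real.sq_sqrt (by linarith)]
    field_simp
  -- The target rate is `Υq`. As `q ≥ 1`, rounding `2q` leaves `q ≤ τ ≤ 3q`, which yields the
  -- constants 3.
  have hs : √(n * Υ * Real.log n) = Υ * q := by
    rw [Real.sqrt_eq_iff_mul_self_eq (by positivity) (by positivity)]
    linear_combination (-(Υ : ℝ)) * hq2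
  have hqn : q ≤ n := by
    refine abs_le_of_sq_le_sq' ?_ (by linarith) |>.2
    nlinarith
  obtain ⟨hτ1, hτ2⟩ := abs_lt.1 hτ
  have hτ3 : (τ : ℝ) ≤ 3 * q := by linarith
  have hτ4 : q ≤ τ := by linarith
  have hτge : 2 ≤ τ := by
    have : (1 : ℝ) < τ := by linarith
    exact_mod_cast this
  -- Here `τ ≤ 3n ≤ n³` for `n ≥ 2`; squaring the factor 3 and applying `log_sq_le_of_mul_log_le`
  -- gives 27.
  have hlogτ : Real.log τ ≤ 3 * Real.log n := by
    have h3 : (3 : ℝ) * Real.log n = Real.log ((n : ℝ) ^ 3) := by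
      rw [Real.log_pow]; norm_num
    rw [h3]
    refine Real.log_le_log (by linarith) ?_
    nlinarith [mul_nonneg (by linarith : (0 : ℝ) ≤ n) (by nlinarith : (0 : ℝ) ≤ (n : ℝ) ^ 2 - 3)]
  have hlogτ0 : 0 ≤ Real.log τ := Real.log_nonneg (by linarith)
  rw [hs]
  refine ⟨hτge, by nlinarith, ?_, ?_, by linarith⟩
  · have h0 : (n : ℝ) * Real.log n ≤ (Υ * q) ^ 2 := by
      rw [← hq2, mul_pow, mul_comm]
      gcongr
      nlinarith
    have h1 := log_sq_le_of_mul_log_le (by linarith) (by positivity) h0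
    nlinarith
  · rw [div_le_iff₀ (by linarith)]
    have h1 : n * Real.log τ ≤ 3 * (q ^ 2 * Υ) := by
      rw [hq2]; nlinarith
    have h2 : 3 * (q ^ 2 * Υ) ≤ 3 * (Υ * q) * τ := by
      nlinarith [mul_nonneg (by positivity : 0 ≤ Υ * q) (by linarith : 0 ≤ τ - q)]
    linarith

/-- A uniform bound in place of the limit: `⌈x⌉/x ≤ 1 + 1/x ≤ 4` for `x = n/τ ≥ 1/3`, and `ln τ ≥ ln
2`. -/
theorem swConst_le {ε : ℝ} (hε : ε ∈ Set.Ioo (1 / 2 : ℝ) 1) {n τ : ℕ} (hn : 1 ≤ n) (hτ : 2 ≤ τ)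
    (hτn : (τ : ℝ) ≤ 3 * n) {g G : ℝ} (hg : 0 ≤ g) (hgG : g ≤ G) :
    swConst ε n τ g ≤ 2 / logEta ε + 2 / Real.log 2 + 8 * ε * G * 4 := by
  have hl := logEta_pos hε
  have hε0 : 0 < ε := by linarith [hε.1]
  have hτ' : (2 : ℝ) ≤ τ := by exact_mod_cast hτ
  have hn' : (1 : ℝ) ≤ n := by exact_mod_cast hn
  have hlog2 : 0 < Real.log 2 := Real.log_pos (by norm_num)
  have hlogτ : Real.log 2 ≤ Real.log τ := Real.log_le_log (by norm_num) hτ'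
  have hlogτ0 : 0 < Real.log τ := by linarith
  have h1 : 2 / Real.log τ * (⌈Real.log τ / logEta ε⌉ : ℝ) ≤ 2 / logEta ε + 2 / Real.log 2 := by
    calc 2 / Real.log τ * (⌈Real.log τ / logEta ε⌉ : ℝ)
        ≤ 2 / Real.log τ * (Real.log τ / logEta ε + 1) := by
          gcongr
          exact (Int.ceil_lt_add_one _).le
      _ = 2 / logEta ε + 2 / Real.log τ := by field_simp
      _ ≤ 2 / logEta ε + 2 / Real.log 2 := by gcongr
  have h2 : (⌈(n : ℝ) / τ⌉ : ℝ) / ((n : ℝ) / τ) ≤ 4 := by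
    have h3 : 0 < (n : ℝ) / τ := by positivity
    rw [div_le_iff₀ h3]
    have h4 : 1 / 3 ≤ (n : ℝ) / τ := by
      rw [le_div_iff₀ (by linarith)]; linarith
    have := (Int.ceil_lt_add_one ((n : ℝ) / τ)).le
    linarith
  have h3 : 0 ≤ (⌈(n : ℝ) / τ⌉ : ℝ) / ((n : ℝ) / τ) := by
    have : (0 : ℝ) ≤ ⌈(n : ℝ) / τ⌉ := by
      exact_mod_cast Int.ceil_nonneg (by positivity : (0 : ℝ) ≤ (n : ℝ) / τ)
    positivity
  rw [swConst]
  have h4 : 8 * ε * g * ((⌈(n : ℝ) / τ⌉ : ℝ) / ((n : ℝ) / τ)) ≤ 8 * ε * G * 4 := by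
    have : 0 ≤ 8 * ε * g := by positivity
    have : 0 ≤ G := hg.trans hgG
    gcongr
  linarith

variable {L K : ℕ}

theorem le_gap {α : ℕ → Fin L → ℝ} {D : ℕ → Finset (Fin L)} {n : ℕ} {δ : ℝ}
    (h : ∀ t < n, ∀ a ∉ D t, ∀ b ∈ D t, δ ≤ α t b - α t a) {a : Fin L}
    (ha : ∃ t < n, a ∉ D t ∧ (D t).Nonempty) : δ ≤ gap α D n a := by
  obtain ⟨t, ht, hat, b, hb⟩ := ha
  refine le_csInf ⟨_, t, ht, hat, b, hb, rfl⟩ ?_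
  rintro x ⟨s, hs, has, c, hc, rfl⟩
  exact h s hs a has c hc

variable {Ω : Type*} [MeasurableSpace Ω] {μ : Measure Ω} [IsProbabilityMeasure μ]
  {n : ℕ} {α : ℕ → Fin L → ℝ} {A : ℕ → Fin L → Ω → Bool}

/-- The regret of CascadeSWUCB with the tuned window size. -/
theorem IsEnvironment.regret_le_of_tuned (hA : IsEnvironment μ n α A) (hK : 1 ≤ K) {ε : ℝ}
    (hε : ε ∈ Set.Ioo (1 / 2 : ℝ) 1) {τ : ℕ} {σ : History L K → Ranking L K}
    (hσ : IsCascadeSWUCB ε τ σ) {D : ℕ → Finset (Fin L)} (hD : IsOptimalSets K n α D) {δ : ℝ}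
    (hδ : 0 < δ) (hgap : ∀ t < n, ∀ a ∉ D t, ∀ b ∈ D t, δ ≤ α t b - α t a)
    (hΥ : 1 ≤ numChanges α n)
    (hτ : |(τ : ℝ) - 2 * √(n * Real.log n / numChanges α n)| < 1) :
    regret μ α A σ n ≤ (3 * L + 27 * L / logEta ε
      + L * (3 * (2 / logEta ε + 2 / Real.log 2 + 8 * ε * (1 / δ) * 4)))
        * √(n * numChanges α n * Real.log n) := by
  have hl := logEta_pos hε
  have hn : 1 ≤ n := by
    by_contra h
    have : n = 0 := by omega
    subst this
    simp [numChanges] at hΥ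
  obtain ⟨hτ2, h1, h2, h3, h4⟩ := tuned_window_bounds hΥ (numChanges_lt hn) hτ
  set s := √(n * numChanges α n * Real.log n) with hs
  have hs0 : 0 ≤ s := Real.sqrt_nonneg _
  have hgap' : ∀ a, (∃ t < n, a ∉ D t) → δ ≤ gap α D n a := fun a ⟨t, ht, hat⟩ =>
    le_gap hgap ⟨t, ht, hat, Finset.card_pos.1 (by rw [(hD t ht).1]; exact hK)⟩
  have hinv : ∀ a, 0 ≤ invGap α D n a ∧ invGap α D n a ≤ 1 / δ := by
    intro a
    unfold invGap
    split_ifs with ha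
    · have := hgap' a ha
      exact ⟨by have := hδ.trans_le this; positivity, one_div_le_one_div_of_le hδ this⟩
    · exact ⟨le_rfl, by positivity⟩
  refine (hA.regret_le hK hε hn hτ2 hσ hD fun a ha => hδ.trans_le (hgap' a ha)).trans ?_
  set Cw := 2 / logEta ε + 2 / Real.log 2 + 8 * ε * (1 / δ) * 4 with hC
  have hC0 : 0 ≤ Cw := by
    have : 0 < ε := by linarith [hε.1]
    have : 0 < Real.log 2 := Real.log_pos (by norm_num)
    positivity
  have hτ' : (2 : ℝ) ≤ τ := by exact_mod_cast hτ2
  have hq : 0 ≤ n * Real.log τ / τ := by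
    have := Real.log_nonneg (by linarith : (1 : ℝ) ≤ τ)
    positivity
  have h5 : ∑ a, swConst ε n τ (invGap α D n a) * (n * Real.log τ / τ) ≤ L * (Cw * (3 * s)) := by
    refine (Finset.sum_le_card_nsmul _ _ (Cw * (3 * s)) fun a _ => ?_).trans
      (le_of_eq (by simp))
    exact (mul_le_mul_of_nonneg_right
      (swConst_le hε hn hτ2 h4 (hinv a).1 (hinv a).2) hq).trans
      (mul_le_mul_of_nonneg_left h3 hC0)
  have h6 : L * Real.log τ ^ 2 / logEta ε ≤ L * (27 * s) / logEta ε := by gcongr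
  have h7 : (L : ℝ) * numChanges α n * τ ≤ L * (3 * s) := by
    rw [mul_assoc]; gcongr
  refine (add_le_add (add_le_add h7 h6) h5).trans (le_of_eq ?_)
  ring

end Rates

end CascadeBandit

theorem theorem2 (L K : ℕ) (hK : 1 ≤ K) (hKL : K ≤ L) (ε : ℝ) (hε : ε ∈ Set.Ioo (1 / 2 : ℝ) 1) :
    -- the regret bound, for every window size
    (∀ (n τ : ℕ), 1 ≤ n → 2 ≤ τ →
      ∀ (Ω : Type u) [MeasurableSpace Ω] (μ : Measure Ω) [IsProbabilityMeasure μ]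
        (α : ℕ → Fin L → ℝ) (A : ℕ → Fin L → Ω → Bool) (D : ℕ → Finset (Fin L))
        (σ : History L K → Ranking L K),
        IsEnvironment μ n α A → IsOptimalSets K n α D → IsCascadeSWUCB ε τ σ →
        (∀ a, (∃ t < n, a ∉ D t) → 0 < gap α D n a) →
        regret μ α A σ n ≤
          L * numChanges α n * τ + L * Real.log τ ^ 2 / logEta ε
            + ∑ a, swConst ε n τ (invGap α D n a) * (n * Real.log τ / τ)) ∧
    -- the limit of the constant
    (∀ (n τ : ℕ → ℕ) (g : ℕ → ℝ) (g₀ : ℝ),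
      Tendsto τ atTop atTop → Tendsto (fun k => (n k : ℝ) / τ k) atTop atTop →
      Tendsto g atTop (𝓝 g₀) →
      Tendsto (fun k => swConst ε (n k) (τ k) (g k)) atTop (𝓝 (2 / logEta ε + 8 * ε * g₀))) ∧
    -- the rate for the tuned window size, rounded to an integer in either direction
    (∀ δ : ℝ, 0 < δ → ∃ C : ℝ, ∀ (n τ : ℕ)
      (Ω : Type u) [MeasurableSpace Ω] (μ : Measure Ω) [IsProbabilityMeasure μ]
        (α : ℕ → Fin L → ℝ) (A : ℕ → Fin L → Ω → Bool) (D : ℕ → Finset (Fin L))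
        (σ : History L K → Ranking L K),
        IsEnvironment μ n α A → IsOptimalSets K n α D → IsCascadeSWUCB ε τ σ →
        (∀ t < n, ∀ a ∉ D t, ∀ b ∈ D t, δ ≤ α t b - α t a) →
        1 ≤ numChanges α n →
        |(τ : ℝ) - 2 * √(n * Real.log n / numChanges α n)| < 1 →
        regret μ α A σ n ≤ C * √(n * numChanges α n * Real.log n)) := by
  refine ⟨?_, ?_, ?_⟩
  · intro n τ hn hτ Ω _ μ _ α A D σ hA hD hσ hgap
    exact hA.regret_le hK hε hn hτ hσ hD hgap
  · intro n τ g g₀ hτ hnτ hg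
    exact tendsto_swConst hε hτ hnτ hg
  · intro δ hδ
    refine ⟨3 * L + 27 * L / logEta ε
      + L * (3 * (2 / logEta ε + 2 / Real.log 2 + 8 * ε * (1 / δ) * 4)),
      fun n τ Ω _ μ _ α A D σ hA hD hσ hgap hΥ hτ => ?_⟩
    exact hA.regret_le_of_tuned hK hε hσ hD hδ hgap hΥ hτ
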